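/- Let $\boldsymbol\varepsilon,\boldsymbol\mu:\mathbb R\to\mathbb C^{2\times2}$ be bounded, piecewise continuous and $1$-periodic. Put $Q=\begin{pmatrix}0&-1\\1&0\end{pmatrix}$, $\mathcal Q=\mathrm{diag}(Q,Q)$, $\mathcal A(z)=i\begin{pmatrix}0&\boldsymbol\mu(z)\\-\boldsymbol\varepsilon(z)&0\end{pmatrix}$, and let $M(\omega)=T(\omega;1)\in\mathbb C^{4\times4}$, where $T(\omega;\cdot)$ is the fundamental matrix, with $T(\omega;0)=I$, of $\Phi'(z)=\omega\,\mathcal Q^{-1}\mathcal A(z)\Phi(z)$. For $\omega\in\mathbb C$ let $\lambda_1(\omega),\dots,\lambda_4(\omega)$ be the eigenvalues of $M(\omega)$, counted with algebraic multiplicity, and $$\mathrm{Ind}(\omega)=\tfrac12\big(\#\{i:|\lambda_i(\omega)|<1\}-\#\{i:|\lambda_i(\omega)|>1\}\big).$$ Let $\mathbb T$ be the unit circle, and let the bands $\omega_n:\mathbb T\to\mathbb C$ be continuous functions such that, for every $\xi\in\mathbb T$, the family $(\omega_n(\xi))_n$ lists all eigenfrequencies at $\xi$, i.e. all zeros of $\omega\mapsto\det(M(\omega)-\xi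 I)$, each as often as its multiplicity. Let $\gamma_n$ be the closed curve $k\mapsto\omega_n(e^{ik})$, and also its image $\omega_n(\mathbb T)$, and let $\Gamma=\bigcup_n\gamma_n$. Let $D_n^e$ be the unbounded component of $\mathbb C\setminus\gamma_n$ and $D_n$ the union of its bounded components. The curves may intersect each other. Fix $n$. Let $D_n^i$ be a bounded component of $\mathbb C\setminus\gamma_n$ whose boundary $\gamma_n^i$ is a simple closed curve. Let $D$ be a connected component of $\mathbb C\setminus\Gamma$ on which the index is $0$ (a principal gapped component), lying outside the regions enclosed by the other curves: $D\cap D_m=\emptyset$ for $m\ne n$. A point $\omega_n(\xi)$, $\xi=e^{ik}$, is called a smooth point of $\gamma_n$ if $\gamma_n$ is $C^1$ near $k$ with nonzero tangent vector at $k$, and $\gamma_n$ passes through the point only once. The outward unit normal at such a point $\zeta$, if it exists, is the unit vector $\nu$ orthogonal to the tangent with $\zeta+t\nu\in D_n^e$ for all small $t>0$. The curve $\gamma_n^i$ is positively oriented if at each smooth point of $\gamma_n$ on $\gamma_n^i$ that has an outward unit normal, this normal is the normalized tangent vector $\frac{d}{dk}\omega_n(e^{ik})$ rotated clockwise by $\pi/2$;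 otherwise it is negatively oriented. Assume: (i) there is $\xi_0\in\mathbb T$ such that $\zeta_0=\omega_n(\xi_0)\in\gamma_n^i$ is a smooth point of $\gamma_n$ with an outward unit normal $\nu$, and $\zeta_0+t\nu\in D$, $\zeta_0-t\nu\in D_n^i$ for all sufficiently small $t>0$; (ii) $\omega_n$ is analytic at $\xi_0$ (near $\xi_0$ it is the restriction to $\mathbb T$ of a holomorphic function). Let $W(\gamma_n;\omega_B)$ be the winding number of $\gamma_n$ about $\omega_B$, that is, $\frac1{2\pi i}\int_{\mathbb T}\frac{d\omega_n(\xi)}{\omega_n(\xi)-\omega_B}$ when this integral makes sense. If $\gamma_n^i$ is positively oriented, then $$\mathrm{Ind}(\omega)=W(\gamma_n;\omega_B)=1\quad\text{for all }\omega\in\Big(D_n^i\setminus\bigcup_{m\ne n}D_m\Big)\setminus\Gamma\ \text{ and all }\omega_B\in D_n^i,$$ and if $\gamma_n^i$ is negatively oriented, then $$\mathrm{Ind}(\omega)=W(\gamma_n;\omega_B)=-1\quad\text{for all such }\omega\text{ and }\omega_B .$$ -/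

import Mathlib

open Set Filter Topology MeasureTheory

noncomputable section

namespace PhotonicCrystal

/-! ### The periodic medium and its transfer matrix -/

/-- On every bounded interval there are only finitely many discontinuities, and one-sided limits
exist everywhere. -/
def IsPiecewiseContinuous (f : ℝ → ℂ) : Prop :=
  (∀ a b : ℝ, {x ∈ Icc a b | ¬ ContinuousAt f x}.Finite) ∧
    ∀ x : ℝ, (∃ l : ℂ, Tendsto f (𝓝[<] x) (𝓝 l)) ∧ ∃ l : ℂ, Tendsto f (𝓝[>] x) (𝓝 l)

/-- Admissible material tensors (in-plane `2 × 2` blocks): entries are bounded, piecewise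
continuous and periodic with period `1`. -/
structure IsAdmissible (f : ℝ → Matrix (Fin 2) (Fin 2) ℂ) : Prop where
  piecewise : ∀ i j, IsPiecewiseContinuous fun z => f z i j
  bounded : ∃ C : ℝ, ∀ z i j, ‖f z i j‖ ≤ C
  periodic : ∀ z, f (z + 1) = f z

/-- A one-dimensional photonic crystal: permittivity and permeability along the `z` axis. -/
structure Medium where
  eps : ℝ → Matrix (Fin 2) (Fin 2) ℂ
  mu : ℝ → Matrix (Fin 2) (Fin 2) ℂ
  eps_adm : IsAdmissible eps
  mu_adm : IsAdmissible mu

/-- Index type of the four field components `(E_x, E_y, H_x, H_y)`. -/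
abbrev Idx := Fin 2 ⊕ Fin 2

/-- The rotation `Q`. -/
def rotQ : Matrix (Fin 2) (Fin 2) ℂ := !![0, -1; 1, 0]

/-- The block matrix `𝒬 = diag(Q, Q)`. -/
def blockQ : Matrix Idx Idx ℂ := Matrix.fromBlocks rotQ 0 0 rotQ

namespace Medium

variable (X : Medium)

/-- `𝒜(z) = i [[0, μ(z)], [-ε(z), 0]]`. -/
def blockA (z : ℝ) : Matrix Idx Idx ℂ :=
  Complex.I • Matrix.fromBlocks 0 (X.mu z) (-X.eps z) 0

/-- The matrix `𝒬⁻¹ 𝒜(z)`; Maxwell's system reads `Φ' = ω 𝒬⁻¹ 𝒜(z) Φ`. -/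
def generator (z : ℝ) : Matrix Idx Idx ℂ := blockQ⁻¹ * X.blockA z

/-- The iterated integrals of the Peano-Baker series of the system `Φ' = ω 𝒬⁻¹ 𝒜(z) Φ`. -/
def iter : ℕ → ℝ → Matrix Idx Idx ℂ
  | 0, _ => 1
  | j + 1, z => Matrix.of fun a b => ∫ s in (0 : ℝ)..z, (X.generator s * iter j s) a b

/-- The transfer matrix `T(ω; z)`, i.e. the fundamental matrix of `Φ' = ω 𝒬⁻¹ 𝒜(z) Φ` equal to the
identity at `z = 0`, given by its Peano-Baker series. That it solves the system is
`transfer_eq` below. -/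
def transfer (w : ℂ) (z : ℝ) : Matrix Idx Idx ℂ :=
  Matrix.of fun a b => ∑' j : ℕ, w ^ j * X.iter j z a b

/-- The transfer matrix `M(ω) = T(ω; 1)` over one period. -/
def monodromy (w : ℂ) : Matrix Idx Idx ℂ := X.transfer w 1

end Medium

lemma IsPiecewiseContinuous.intervalIntegrable {f : ℝ → ℂ} (hf : IsPiecewiseContinuous f)
    {C : ℝ} (hC : ∀ z, ‖f z‖ ≤ C) (a b : ℝ) : IntervalIntegrable f volume a b := by
  set S : Set ℝ := {x | ¬ ContinuousAt f x} with hS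
  have hcount : S.Countable := by
    have h : S = ⋃ n : ℕ, {x ∈ Icc (-(n : ℝ)) n | ¬ ContinuousAt f x} := by
      ext x
      simp only [hS, mem_ofPred_eq, mem_iUnion, mem_Icc]
      constructor
      · intro hx
        obtain ⟨n, hn⟩ := exists_nat_ge |x|
        exact ⟨n, abs_le.mp hn, hx⟩
      · rintro ⟨n, -, hx⟩
        exact hx
    rw [h]
    exact countable_iUnion fun n => (hf.1 _ _).countable
  have hmeas : MeasurableSet Sᶜ := hcount.measurableSet.compl
  have hc : ContinuousOn f Sᶜ := fun x hx => by
    have : ContinuousAt f x := by simpa [hS] using hx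
    exact this.continuousWithinAt
  have h1 : AEStronglyMeasurable f (volume.restrict Sᶜ) := hc.aestronglyMeasurable hmeas
  have h2 : volume.restrict Sᶜ = (volume : Measure ℝ) := by
    apply Measure.restrict_eq_self_of_ae_mem
    exact hcount.ae_notMem volume
  rw [h2] at h1
  rw [intervalIntegrable_iff]
  exact Measure.integrableOn_of_bounded (M := C) (by simp) h1 (Eventually.of_forall hC)

lemma blockQ_inv : blockQ⁻¹ = Matrix.fromBlocks (-rotQ) 0 0 (-rotQ) := by
  apply Matrix.inv_eq_left_inv
  rw [blockQ, Matrix.fromBlocks_multiply, rotQ, ← Matrix.fromBlocks_one]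
  simp [Matrix.one_fin_two]

namespace Medium

variable (X : Medium)

lemma generator_eq (z : ℝ) : X.generator z =
    Matrix.fromBlocks 0 (Complex.I • !![X.mu z 1 0, X.mu z 1 1; -X.mu z 0 0, -X.mu z 0 1])
      (Complex.I • !![-X.eps z 1 0, -X.eps z 1 1; X.eps z 0 0, X.eps z 0 1]) 0 := by
  have h : ∀ m : Matrix (Fin 2) (Fin 2) ℂ, rotQ * m = !![-m 1 0, -m 1 1; m 0 0, m 0 1] := by
    intro m
    ext i j
    fin_cases i <;> fin_cases j <;> simp [rotQ, Matrix.mul_apply, Fin.sum_univ_two]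
  rw [generator, blockQ_inv, blockA, Matrix.mul_smul, Matrix.fromBlocks_multiply,
    Matrix.fromBlocks_smul]
  simp only [Matrix.neg_mul, Matrix.zero_mul, Matrix.mul_zero, add_zero, zero_add, h, smul_zero,
    neg_zero, Matrix.mul_neg, neg_neg]
  congr 1
  ext i j
  fin_cases i <;> fin_cases j <;> simp

lemma generator_bound : ∃ C : ℝ, 0 ≤ C ∧ ∀ z a b, ‖X.generator z a b‖ ≤ C := by
  obtain ⟨C₁, h₁⟩ := X.eps_adm.bounded
  obtain ⟨C₂, h₂⟩ := X.mu_adm.bounded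
  have p₁ : 0 ≤ C₁ := (norm_nonneg _).trans (h₁ 0 0 0)
  have p₂ : 0 ≤ C₂ := (norm_nonneg _).trans (h₂ 0 0 0)
  refine ⟨C₁ + C₂, by positivity, fun z a b => ?_⟩
  have q₁ : ∀ i j, ‖X.eps z i j‖ ≤ C₁ + C₂ := fun i j => (h₁ z i j).trans (by linarith)
  have q₂ : ∀ i j, ‖X.mu z i j‖ ≤ C₁ + C₂ := fun i j => (h₂ z i j).trans (by linarith)
  rw [generator_eq]
  rcases a with a | a <;> rcases b with b | b <;> fin_cases a <;> fin_cases b <;>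
    simp [q₁, q₂] <;> linarith

lemma generator_intervalIntegrable (a b : Idx) (s t : ℝ) :
    IntervalIntegrable (fun z => X.generator z a b) volume s t := by
  obtain ⟨C₁, h₁⟩ := X.eps_adm.bounded
  obtain ⟨C₂, h₂⟩ := X.mu_adm.bounded
  have q₁ : ∀ i j, IntervalIntegrable (fun z => X.eps z i j) volume s t := fun i j =>
    (X.eps_adm.piecewise i j).intervalIntegrable (fun z => h₁ z i j) s t
  have q₂ : ∀ i j, IntervalIntegrable (fun z => X.mu z i j) volume s t := fun i j =>
    (X.mu_adm.piecewise i j).intervalIntegrable (fun z => h₂ z i j) s t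
  simp only [generator_eq]
  rcases a with a | a <;> rcases b with b | b <;> fin_cases a <;> fin_cases b <;>
    simp <;>
    first
    | exact (q₁ _ _).const_mul _
    | exact (q₂ _ _).const_mul _
    | exact ((q₁ _ _).const_mul _).neg
    | exact ((q₂ _ _).const_mul _).neg

lemma mul_intervalIntegrable {N : ℝ → Matrix Idx Idx ℂ} (hN : ∀ a b, Continuous fun z => N z a b)
    (a b : Idx) (s t : ℝ) :
    IntervalIntegrable (fun z => (X.generator z * N z) a b) volume s t := by
  simp only [Matrix.mul_apply]
  have := IntervalIntegrable.sum (μ := volume) (a := s) (b := t) Finset.univ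
    (f := fun c z => X.generator z a c * N z c b) fun c _ =>
      (X.generator_intervalIntegrable a c s t).mul_continuousOn (hN c b).continuousOn
  refine this.congr ?_
  intro z _
  simp [Finset.sum_apply]

lemma iter_continuous (j : ℕ) : ∀ a b : Idx, Continuous fun z => X.iter j z a b := by
  induction j with
  | zero => intro a b; simp only [iter]; exact continuous_const
  | succ j ih =>
    intro a b
    simp only [iter, Matrix.of_apply]
    exact intervalIntegral.continuous_primitive (X.mul_intervalIntegrable ih a b) 0

lemma mul_bound {C K : ℝ} {G N : Matrix Idx Idx ℂ} (hC : 0 ≤ C) (hG : ∀ a b, ‖G a b‖ ≤ C)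
    (hN : ∀ a b, ‖N a b‖ ≤ K) (a b : Idx) : ‖(G * N) a b‖ ≤ 4 * C * K := by
  rw [Matrix.mul_apply]
  calc ‖∑ c, G a c * N c b‖ ≤ ∑ _c : Idx, C * K := norm_sum_le_of_le _ fun c _ => by
        rw [norm_mul]
        exact mul_le_mul (hG a c) (hN c b) (norm_nonneg _) hC
    _ = 4 * C * K := by
        simp
        ring

lemma iter_bound {C : ℝ} (hC : 0 ≤ C) (h : ∀ z a b, ‖X.generator z a b‖ ≤ C) (j : ℕ) :
    ∀ z : ℝ, 0 ≤ z → ∀ a b : Idx, ‖X.iter j z a b‖ ≤ (4 * C * z) ^ j / j.factorial := by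
  induction j with
  | zero =>
    intro z _ a b
    simp only [iter, Matrix.one_apply]
    split_ifs <;> simp
  | succ j ih =>
    intro z hz a b
    simp only [iter, Matrix.of_apply]
    have hint : IntervalIntegrable (fun s : ℝ => 4 * C * ((4 * C * s) ^ j / j.factorial))
        volume 0 z := Continuous.intervalIntegrable (by fun_prop) _ _
    refine (intervalIntegral.norm_integral_le_of_norm_le hz
      (Eventually.of_forall fun s hs => mul_bound hC (h s) (ih s hs.1.le) a b) hint).trans ?_
    have e : (fun s : ℝ => 4 * C * ((4 * C * s) ^ j / j.factorial)) =
        fun s => ((4 * C) ^ (j + 1) / j.factorial) * s ^ j := by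
      funext s
      rw [mul_pow]
      ring
    rw [e, intervalIntegral.integral_const_mul, integral_pow, mul_pow _ z, Nat.factorial_succ]
    push_cast
    apply le_of_eq
    have : (j.factorial : ℝ) ≠ 0 := by positivity
    field_simp
    ring

lemma transfer_hasSum (w : ℂ) {z : ℝ} (hz : 0 ≤ z) (a b : Idx) :
    HasSum (fun j => w ^ j * X.iter j z a b) (X.transfer w z a b) := by
  obtain ⟨C, hC, h⟩ := X.generator_bound
  refine Summable.hasSum (Summable.of_norm_bounded
    (Real.summable_pow_div_factorial (‖w‖ * (4 * C * z))) fun j => ?_)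
  rw [norm_mul, norm_pow, mul_pow, mul_div_assoc]
  exact mul_le_mul_of_nonneg_left (X.iter_bound hC h j z hz a b) (by positivity)

/-- The Peano-Baker series solves `Φ' = ω 𝒬⁻¹ 𝒜(z) Φ`, `Φ(0) = 1` (in integrated form). -/
theorem transfer_eq (w : ℂ) {z : ℝ} (hz : 0 ≤ z) (a b : Idx) :
    X.transfer w z a b = (1 : Matrix Idx Idx ℂ) a b +
      ∫ s in (0 : ℝ)..z, w * (X.generator s * X.transfer w s) a b := by
  obtain ⟨C, hC, h⟩ := X.generator_bound
  have h1 : HasSum (fun j => w ^ (j + 1) * X.iter (j + 1) z a b)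
      (∫ s in (0 : ℝ)..z, w * (X.generator s * X.transfer w s) a b) := by
    have e : ∀ j, w ^ (j + 1) * X.iter (j + 1) z a b =
        ∫ s in (0 : ℝ)..z, w ^ (j + 1) * (X.generator s * X.iter j s) a b := by
      intro j
      rw [intervalIntegral.integral_const_mul]
      simp [iter]
    simp only [e]
    refine intervalIntegral.hasSum_integral_of_dominated_convergence
      (fun j _ => ‖w‖ * (4 * C) * ((‖w‖ * (4 * C * z)) ^ j / j.factorial)) ?_ ?_ ?_ ?_ ?_
    · intro j
      have := ((X.mul_intervalIntegrable (X.iter_continuous j) a b 0 z).const_mul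
        (w ^ (j + 1)))
      exact (intervalIntegrable_iff.mp this).aestronglyMeasurable
    · refine fun j => Eventually.of_forall fun s hs => ?_
      rw [uIoc_of_le hz] at hs
      rw [norm_mul, norm_pow]
      have := mul_bound hC (h s) (X.iter_bound hC h j s hs.1.le) a b
      have h3 : (4 * C * s) ^ j / j.factorial ≤ (4 * C * z) ^ j / j.factorial := by
        have : 0 ≤ s := hs.1.le
        have : s ≤ z := hs.2
        gcongr
      calc ‖w‖ ^ (j + 1) * ‖(X.generator s * X.iter j s) a b‖
          ≤ ‖w‖ ^ (j + 1) * (4 * C * ((4 * C * z) ^ j / j.factorial)) := by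
            gcongr
            exact this.trans (by gcongr)
        _ = _ := by
            rw [mul_pow ‖w‖]
            ring
    · exact Eventually.of_forall fun s _ =>
        (Real.summable_pow_div_factorial _).mul_left _
    · exact intervalIntegrable_const
    · refine Eventually.of_forall fun s hs => ?_
      rw [uIoc_of_le hz] at hs
      simp only [Matrix.mul_apply, Finset.mul_sum]
      refine hasSum_sum fun c _ => ?_
      have := (X.transfer_hasSum w hs.1.le c b).mul_left (w * X.generator s a c)
      have e1 : (fun j => w ^ (j + 1) * (X.generator s a c * X.iter j s c b)) =
          fun j => w * X.generator s a c * (w ^ j * X.iter j s c b) := by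
        funext j
        ring
      rw [e1, ← mul_assoc]
      exact this
  have h2 := ((hasSum_nat_add_iff (f := fun j => w ^ j * X.iter j z a b) 1).mp h1).unique
    (X.transfer_hasSum w hz a b)
  rw [← h2]
  simp [iter, add_comm]

end Medium

/-! ### Eigenfrequencies, bands and the index -/

/-- `P(ω, ξ) = det (M(ω) - ξ I)`. -/
def charFun (X : Medium) (xi w : ℂ) : ℂ := (X.monodromy w - xi • (1 : Matrix Idx Idx ℂ)).det

/-- The functions `ω_n : 𝕋 → ℂ` are the bands of the crystal: they are continuous and, for each
`ξ ∈ 𝕋`, the numbers `ω_n(ξ)` list all eigenfrequencies of the Bloch problem at `ξ`, i.e. all zeros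
of `ω ↦ det (M(ω) - ξ I)`, with multiplicity. -/
structure IsBandFamily (X : Medium) {ι : Type*} (om : ι → Circle → ℂ) : Prop where
  continuous : ∀ n, Continuous (om n)
  encard_eq : ∀ (xi : Circle) (w : ℂ), {n | om n xi = w}.encard = analyticOrderAt (charFun X xi) w

/-- `Ind(ω) = (#{i : |λ_i(ω)| < 1} - #{i : |λ_i(ω)| > 1}) / 2`, with the eigenvalues `λ_i(ω)` of
`M(ω)` counted with algebraic multiplicity. -/
def ind (X : Medium) (w : ℂ) : ℚ :=
  (((X.monodromy w).charpoly.roots.countP fun l => ‖l‖ < 1 : ℚ) -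
    ((X.monodromy w).charpoly.roots.countP fun l => 1 < ‖l‖ : ℚ)) / 2

/-- `Γ`, the union of all dispersion curves. -/
def dispersionSet {ι : Type*} (om : ι → Circle → ℂ) : Set ℂ := ⋃ n, range (om n)

/-- `D` is a principal gapped component: a connected component of `Γᶜ` with index `0`. -/
def IsPrincipalGapped (X : Medium) {ι : Type*} (om : ι → Circle → ℂ) (D : Set ℂ) : Prop :=
  ∃ w ∈ (dispersionSet om)ᶜ, D = connectedComponentIn (dispersionSet om)ᶜ w ∧ ind X w = 0

/-! ### Closed curves in the plane -/

/-- `D` is a bounded connected component of the complement of the curve `γ`. -/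
def IsBoundedComponent (γ : Circle → ℂ) (D : Set ℂ) : Prop :=
  ∃ w ∈ (range γ)ᶜ, D = connectedComponentIn (range γ)ᶜ w ∧ Bornology.IsBounded D

/-- The union of all bounded components of the complement of `γ`. -/
def boundedRegion (γ : Circle → ℂ) : Set ℂ := ⋃₀ {D | IsBoundedComponent γ D}

/-- The unbounded component of the complement of `γ`. -/
def exteriorRegion (γ : Circle → ℂ) : Set ℂ :=
  {w ∈ (range γ)ᶜ | ¬ Bornology.IsBounded (connectedComponentIn (range γ)ᶜ w)}

/-- `J` is a simple closed curve. -/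
def IsSimpleClosedCurve (J : Set ℂ) : Prop :=
  ∃ c : Circle → ℂ, Continuous c ∧ Function.Injective c ∧ range c = J

/-- The tangent vector `d/dk γ(e^{ik})`. -/
def tangent (γ : Circle → ℂ) (k : ℝ) : ℂ := deriv (fun s : ℝ => γ (Circle.exp s)) k

/-- `γ(e^{ik})` is a smooth point of the closed curve `γ`: near `k` the curve is regular, and the
point is passed only once. -/
def IsSmoothPoint (γ : Circle → ℂ) (k : ℝ) : Prop :=
  ContDiffAt ℝ 1 (fun s : ℝ => γ (Circle.exp s)) k ∧ tangent γ k ≠ 0 ∧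
    ∀ xi : Circle, γ xi = γ (Circle.exp k) → xi = Circle.exp k

/-- `ν` is the outward unit normal of `γ` at `γ(e^{ik})`: it is a unit vector orthogonal to the
tangent, and it points into the unbounded component of the complement of `γ`. -/
def IsOutwardUnitNormal (γ : Circle → ℂ) (k : ℝ) (ν : ℂ) : Prop :=
  ‖ν‖ = 1 ∧ inner ℝ (tangent γ k) ν = 0 ∧
    ∀ᶠ t : ℝ in 𝓝[>] 0, γ (Circle.exp k) + t * ν ∈ exteriorRegion γ

/-- The part `J` of `γ` is oriented counterclockwise: at its smooth points the outward normal, where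
there is one, is the tangent vector rotated clockwise by `π / 2` and normalized. -/
def IsPositivelyOriented (γ : Circle → ℂ) (J : Set ℂ) : Prop :=
  ∀ (k : ℝ) (ν : ℂ), IsSmoothPoint γ k → γ (Circle.exp k) ∈ J → IsOutwardUnitNormal γ k ν →
    ν = -Complex.I * (tangent γ k / ‖tangent γ k‖)

/-- Otherwise it is oriented clockwise. -/
def IsNegativelyOriented (γ : Circle → ℂ) (J : Set ℂ) : Prop := ¬ IsPositivelyOriented γ J

/-- `γ` is analytic at `ξ₀ ∈ 𝕋`: near `ξ₀` it is the restriction of a function that is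
holomorphic in a neighbourhood of `ξ₀` in `ℂ`. -/
def IsAnalyticAtCircle (γ : Circle → ℂ) (xi : Circle) : Prop :=
  ∃ F : ℂ → ℂ, AnalyticAt ℂ F xi ∧ ∀ᶠ eta : Circle in 𝓝 xi, γ eta = F eta

/-- The winding number `W(γ; z)` of the closed curve `γ` about `z` is `m`: along a continuous branch
of `log (γ - z)`, the logarithm changes by `2 π i m` in one turn. -/
def HasWindingNumber (γ : Circle → ℂ) (z : ℂ) (m : ℤ) : Prop :=
  ∃ θ : ℝ → ℂ, Continuous θ ∧ (∀ k : ℝ, Complex.exp (θ k) = γ (Circle.exp k) - z) ∧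
    θ (2 * Real.pi) - θ 0 = 2 * Real.pi * Complex.I * m

/-- Where the contour integral makes sense, `W(γ; z) = (2πi)⁻¹ ∮ dγ / (γ - z)`. -/
theorem HasWindingNumber.eq_integral {γ : Circle → ℂ} {z : ℂ} {m : ℤ} (h : HasWindingNumber γ z m)
    {s : Set ℝ} (hs : s.Countable)
    (hd : ∀ k ∉ s, DifferentiableAt ℝ (fun k : ℝ => γ (Circle.exp k)) k)
    (hi : IntervalIntegrable (fun k => tangent γ k / (γ (Circle.exp k) - z)) volume
      0 (2 * Real.pi)) :
    (m : ℂ) = (2 * Real.pi * Complex.I)⁻¹ *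
      ∫ k in (0 : ℝ)..(2 * Real.pi), tangent γ k / (γ (Circle.exp k) - z) := by
  obtain ⟨θ, hc, hθ, hm⟩ := h
  have hne : ∀ k, γ (Circle.exp k) - z ≠ 0 := fun k => by
    rw [← hθ k]
    exact Complex.exp_ne_zero _
  have key : ∀ k ∉ s, HasDerivAt θ (tangent γ k / (γ (Circle.exp k) - z)) k := by
    intro k hk
    have h1 : HasDerivAt (fun x : ℝ => γ (Circle.exp x) - z) (tangent γ k) k :=
      (hd k hk).hasDerivAt.sub_const z
    have h2 : HasDerivAt (fun x : ℝ => (γ (Circle.exp x) - z) / (γ (Circle.exp k) - z))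
        (tangent γ k / (γ (Circle.exp k) - z)) k := h1.div_const _
    have h3 : HasDerivAt
        (fun x : ℝ => Complex.log ((γ (Circle.exp x) - z) / (γ (Circle.exp k) - z)))
        (tangent γ k / (γ (Circle.exp k) - z)) k := by
      have := h2.clog_real (by rw [div_self (hne k)]; exact Complex.one_mem_slitPlane)
      simpa [div_self (hne k)] using this
    have h4 := h3.add_const (θ k)
    refine h4.congr_of_eventuallyEq ?_
    have hb : ∀ᶠ x in 𝓝 k, ‖θ x - θ k‖ < 1 := by
      have : Tendsto (fun x => θ x - θ k) (𝓝 k) (𝓝 0) := by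
        have := (hc.tendsto k).sub_const (θ k)
        simpa using this
      simpa using this.norm.eventually (gt_mem_nhds (by simp : ‖(0 : ℂ)‖ < 1))
    filter_upwards [hb] with x hx
    rw [← hθ x, ← hθ k, ← Complex.exp_sub, Complex.log_exp]
    · ring
    · have := Complex.abs_im_le_norm (θ x - θ k)
      have := (abs_le.mp (this.trans hx.le)).1
      linarith [Real.pi_gt_three]
    · have := Complex.abs_im_le_norm (θ x - θ k)
      have := (abs_le.mp (this.trans hx.le)).2
      linarith [Real.pi_gt_three]
  rw [integral_eq_of_hasDerivAt_off_countable θ _ hs hc.continuousOn (fun x hx => key x hx.2) hi,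
    hm]
  have : (2 * Real.pi * Complex.I : ℂ) ≠ 0 := Complex.two_pi_I_ne_zero
  field_simp

end PhotonicCrystal

end

open PhotonicCrystal

namespace PhotonicCrystal

/-! ### Winding numbers -/

/-! The link between index and winding numbers is the function `charFun X ξ ω`, whose winding number
around 0, as ξ runs over the unit circle with ω fixed, can be read in two ways. As a polynomial in ξ
it is the product of ξ − λ over the eigenvalues of M(ω), so its winding number counts the
eigenvalues in the unit disk. Off Γ no eigenvalue is unimodular, and this count is Ind(ω) + 2
(`IsBandFamily.ind_eq`).

As an entire function of ω its zeros are the band values. Only finitely many bands meet a given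
disk, so there it equals a finite product of ω − ω_i(ξ) times a zero-free factor that is jointly
continuous in (ξ, ω). The winding number of that factor does not depend on ω in the disk, hence the
eigenvalue counts at two points off Γ differ by the total difference of the bands' winding numbers
about them (`IsBandFamily.countP_sub_eq`). In D every band has winding number 0 and the index is 0.
Outside the regions enclosed by the other curves only γ_n contributes, so the index is the winding
number of γ_n (`IsBandFamily.ind_eq_of_hasWindingNumber`).

It remains to find this winding number in the bounded component, where the orientation enters. At a
smooth point the curve is locally a graph over its tangent, and the winding number increases by one
from the right to the left of the tangent (`IsGraphNear.hasWindingNumber_add_one`). One side is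
exterior, with winding number 0; a local path argument shows that the other side is the bounded
component. Hence the value is ±1, with the sign given by the direction of the outward normal
relative to the tangent (`hasWindingNumber_of_isBoundedComponent`). -/

/-- A continuous logarithm of `1` on a preconnected set is constant. -/
lemma eq_of_exp_eq_one {α : Type*} [TopologicalSpace α] {S : Set α} (hS : IsPreconnected S)
    {θ : α → ℂ} (hθ : ContinuousOn θ S) (h1 : ∀ x ∈ S, Complex.exp (θ x) = 1) {x y : α}
    (hx : x ∈ S) (hy : y ∈ S) : θ x = θ y := by
  set g : α → ℝ := fun x => (θ x / (2 * Real.pi * Complex.I)).re with hg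
  have hne : (2 * Real.pi * Complex.I : ℂ) ≠ 0 := Complex.two_pi_I_ne_zero
  have hgc : ContinuousOn g S := Complex.continuous_re.comp_continuousOn (hθ.div_const _)
  have hint : ∀ z ∈ S, ∃ n : ℤ, θ z = n * (2 * Real.pi * Complex.I) ∧ g z = n := fun z hz => by
    obtain ⟨n, hn⟩ := Complex.exp_eq_one_iff.mp (h1 z hz)
    refine ⟨n, hn, ?_⟩
    simp only [hg, hn, mul_div_cancel_right₀ _ hne, Complex.intCast_re]
  have hord : (g '' S).OrdConnected := (hS.image g hgc).ordConnected
  have key : ∀ a ∈ S, ∀ b ∈ S, g a ≤ g b := by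
    intro a ha b hb
    by_contra! hlt
    obtain ⟨p, -, hp⟩ := hint a ha
    obtain ⟨q, -, hq⟩ := hint b hb
    have hqp : q + 1 ≤ p := by
      rw [hp, hq] at hlt
      exact_mod_cast hlt
    have hqp' : (q : ℝ) + 1 ≤ p := by exact_mod_cast hqp
    -- `g` takes integer values on `S`; by connectedness it would also attain a half-integer between
    -- two distinct ones, which the parity argument excludes.
    obtain ⟨c, hc, hgc⟩ := hord.out (mem_image_of_mem g hb) (mem_image_of_mem g ha)
      (show g b + 1 / 2 ∈ Icc (g b) (g a) from ⟨by linarith, by linarith⟩)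
    obtain ⟨r, -, hr⟩ := hint c hc
    have h2 : ((2 * r : ℤ) : ℝ) = ((2 * q + 1 : ℤ) : ℝ) := by
      push_cast
      linarith
    have h3 : 2 * r = 2 * q + 1 := by exact_mod_cast h2
    omega
  obtain ⟨p, hp, hp'⟩ := hint x hx
  obtain ⟨q, hq, hq'⟩ := hint y hy
  have : (p : ℝ) = q := by rw [← hp', ← hq']; exact le_antisymm (key x hx y hy) (key y hy x hx)
  rw [hp, hq, Int.cast_injective this]

/-- The parameter line is simply connected, so the logarithm exists on ℝ. It need not be periodic,
and its defect over one turn is the winding number. -/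
lemma exists_continuous_log {f : Circle → ℂ} (hf : Continuous f) (h0 : ∀ ξ, f ξ ≠ 0) :
    ∃ θ : ℝ → ℂ, Continuous θ ∧ ∀ k : ℝ, Complex.exp (θ k) = f (Circle.exp k) := by
  have hsc : IsSimplyConnected (univ : Set ℝ) := by
    have : ContractibleSpace (univ : Set ℝ) := convex_univ.contractibleSpace univ_nonempty
    exact (inferInstance : SimplyConnectedSpace (univ : Set ℝ))
  obtain ⟨θ, hθ, he⟩ := Complex.exists_continuousOn_eqOn_exp_comp (X := ℝ) hsc isOpen_univ
    (g := fun k => f (Circle.exp k)) (hf.comp Circle.exp.continuous).continuousOn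
    (by simp [h0])
  exact ⟨θ, continuousOn_univ.mp hθ, fun k => he (mem_univ k)⟩

/-- The increment over one period of a continuous logarithm does not depend on the base point. -/
lemma log_increment_eq {f : Circle → ℂ} {θ : ℝ → ℂ} (hθ : Continuous θ)
    (he : ∀ k : ℝ, Complex.exp (θ k) = f (Circle.exp k)) (k l : ℝ) :
    θ (k + 2 * Real.pi) - θ k = θ (l + 2 * Real.pi) - θ l := by
  refine eq_of_exp_eq_one (S := univ) isPreconnected_univ
    (θ := fun k => θ (k + 2 * Real.pi) - θ k) (by fun_prop) (fun x _ => ?_) (mem_univ _)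
    (mem_univ _)
  rw [Complex.exp_sub, he, he, Circle.exp_add_two_pi, div_self]
  rw [← he]
  exact Complex.exp_ne_zero _

lemma hasWindingNumber_sub {γ : Circle → ℂ} {z : ℂ} {m : ℤ} :
    HasWindingNumber (fun ξ => γ ξ - z) 0 m ↔ HasWindingNumber γ z m := by
  simp [HasWindingNumber]

lemma exists_hasWindingNumber {f : Circle → ℂ} (hf : Continuous f) (h0 : ∀ ξ, f ξ ≠ 0) :
    ∃ m, HasWindingNumber f 0 m := by
  obtain ⟨θ, hθ, he⟩ := exists_continuous_log hf h0
  have h1 : Complex.exp (θ (2 * Real.pi) - θ 0) = 1 := by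
    rw [Complex.exp_sub, he, he, Circle.exp_two_pi, Circle.exp_zero, div_self (h0 1)]
  obtain ⟨m, hm⟩ := Complex.exp_eq_one_iff.mp h1
  exact ⟨m, θ, hθ, by simpa using he, by rw [hm]; ring⟩

lemma HasWindingNumber.ne_zero {f : Circle → ℂ} {m : ℤ} (h : HasWindingNumber f 0 m)
    (ξ : Circle) : f ξ ≠ 0 := by
  obtain ⟨θ, -, he, -⟩ := h
  obtain ⟨k, rfl⟩ := Circle.exp_surjective ξ
  have := he k
  rw [sub_zero] at this
  rw [← this]
  exact Complex.exp_ne_zero _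

lemma HasWindingNumber.unique {f : Circle → ℂ} {m m' : ℤ} (h : HasWindingNumber f 0 m)
    (h' : HasWindingNumber f 0 m') : m = m' := by
  have h0 := h.ne_zero
  obtain ⟨θ, hθ, he, hm⟩ := h
  obtain ⟨θ', hθ', he', hm'⟩ := h'
  have := eq_of_exp_eq_one (S := univ) isPreconnected_univ (θ := fun k => θ k - θ' k)
    (by fun_prop) (fun x _ => by
      rw [Complex.exp_sub, he, he', sub_zero, div_self (h0 _)]) (mem_univ (2 * Real.pi))
      (mem_univ 0)
  have h2 : (2 * Real.pi * Complex.I : ℂ) * m = 2 * Real.pi * Complex.I * m' := by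
    rw [← hm, ← hm']
    linear_combination this
  exact_mod_cast mul_left_cancel₀ Complex.two_pi_I_ne_zero h2

lemma HasWindingNumber.mul {f g : Circle → ℂ} {m n : ℤ} (hf : HasWindingNumber f 0 m)
    (hg : HasWindingNumber g 0 n) : HasWindingNumber (fun ξ => f ξ * g ξ) 0 (m + n) := by
  obtain ⟨θ, hθ, he, hm⟩ := hf
  obtain ⟨θ', hθ', he', hm'⟩ := hg
  refine ⟨fun k => θ k + θ' k, by fun_prop, fun k => ?_, ?_⟩
  · rw [Complex.exp_add, he, he']
    simp
  · push_cast
    linear_combination hm + hm'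

lemma hasWindingNumber_const {c : ℂ} (hc : c ≠ 0) : HasWindingNumber (fun _ => c) 0 0 :=
  ⟨fun _ => Complex.log c, continuous_const, fun k => by simp [Complex.exp_log hc], by simp⟩

lemma hasWindingNumber_coe : HasWindingNumber (fun ξ => (ξ : ℂ)) 0 1 :=
  ⟨fun k => k * Complex.I, by fun_prop, fun k => by simp [Circle.coe_exp], by simp⟩

lemma hasWindingNumber_prod {κ : Type*} (F : Finset κ) (f : κ → Circle → ℂ) (m : κ → ℤ)
    (h : ∀ i ∈ F, HasWindingNumber (f i) 0 (m i)) :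
    HasWindingNumber (fun ξ => ∏ i ∈ F, f i ξ) 0 (∑ i ∈ F, m i) := by
  classical
  induction F using Finset.induction_on with
  | empty => simpa using hasWindingNumber_const one_ne_zero
  | insert a F ha ih =>
    simp only [Finset.prod_insert ha, Finset.sum_insert ha]
    exact (h a (Finset.mem_insert_self _ _)).mul
      (ih fun i hi => h i (Finset.mem_insert_of_mem hi))

/-- Rouché's principle for winding numbers. -/
lemma HasWindingNumber.of_norm_sub_lt {f g : Circle → ℂ} {m : ℤ} (hg : HasWindingNumber g 0 m)
    (hgc : Continuous g) (hf : Continuous f) (h : ∀ ξ, ‖f ξ - g ξ‖ < ‖g ξ‖) :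
    HasWindingNumber f 0 m := by
  have h0 := hg.ne_zero
  have hslit : ∀ ξ, f ξ / g ξ ∈ Complex.slitPlane := fun ξ => by
    have h1 : ‖f ξ / g ξ - 1‖ < 1 := by
      rw [div_sub_one (h0 ξ), norm_div]
      exact (div_lt_one (norm_pos_iff.mpr (h0 ξ))).mpr (h ξ)
    simpa using Complex.mem_slitPlane_of_norm_lt_one h1
  -- The quotient stays in the disk of radius 1 about 1, so the principal logarithm is a continuous
  -- and periodic choice.
  have hq : HasWindingNumber (fun ξ => f ξ / g ξ) 0 0 := by
    refine ⟨fun k => Complex.log (f (Circle.exp k) / g (Circle.exp k)), ?_, fun k => ?_, ?_⟩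
    · refine Continuous.clog ?_ fun k => hslit _
      exact (hf.comp Circle.exp.continuous).div (hgc.comp Circle.exp.continuous) fun k => h0 _
    · rw [Complex.exp_log (Complex.slitPlane_ne_zero (hslit _)), sub_zero]
    · simp
  have := hq.mul hg
  simpa [h0] using this

/-- Homotopy invariance of the winding number. -/
lemma hasWindingNumber_of_homotopy {Y : Type*} [TopologicalSpace Y] [PreconnectedSpace Y]
    {H : Y × Circle → ℂ} (hH : Continuous H) (h0 : ∀ p, H p ≠ 0) {y y' : Y} {m : ℤ}
    (h : HasWindingNumber (fun ξ => H (y, ξ)) 0 m) :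
    HasWindingNumber (fun ξ => H (y', ξ)) 0 m := by
  have hc : ∀ y, Continuous fun ξ => H (y, ξ) := fun y => by fun_prop
  choose w hw using fun y => exists_hasWindingNumber (hc y) fun ξ => h0 (y, ξ)
  have hloc : IsLocallyConstant w := by
    rw [IsLocallyConstant.iff_eventually_eq]
    intro y
    -- Compactness of the circle makes the Rouché estimate uniform in ξ.
    have h1 : ∀ᶠ y' in 𝓝 y, ∀ ξ ∈ (univ : Set Circle),
        ‖H (y', ξ) - H (y, ξ)‖ < ‖H (y, ξ)‖ := by
      refine isCompact_univ.eventually_forall_of_forall_eventually fun ξ _ => ?_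
      have hcont : Continuous fun p : Y × Circle => ‖H p - H (y, p.2)‖ - ‖H (y, p.2)‖ := by
        fun_prop
      have := hcont.continuousAt.eventually_lt (x₀ := (y, ξ)) continuousAt_const
        (show _ < (0 : ℝ) by simpa using h0 (y, ξ))
      filter_upwards [this] with p hp using sub_neg.mp hp
    filter_upwards [h1] with y' hy'
    exact (hw y').unique ((hw y).of_norm_sub_lt (hc y) (hc y') fun ξ => hy' ξ (mem_univ ξ))
  have hm : w y = m := (hw y).unique h
  rw [← hm, hloc.apply_eq_of_preconnectedSpace y y']
  exact hw y'

/-- The winding number is constant on preconnected sets that avoid the curve. -/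
lemma HasWindingNumber.of_isPreconnected {γ : Circle → ℂ} (hγ : Continuous γ) {S : Set ℂ}
    (hS : IsPreconnected S) (hd : S ⊆ (range γ)ᶜ) {z z' : ℂ} (hz : z ∈ S) (hz' : z' ∈ S) {m : ℤ}
    (h : HasWindingNumber γ z m) : HasWindingNumber γ z' m := by
  have : PreconnectedSpace S := isPreconnected_iff_preconnectedSpace.mp hS
  rw [← hasWindingNumber_sub] at h ⊢
  refine hasWindingNumber_of_homotopy (H := fun p : S × Circle => γ p.2 - p.1) (by fun_prop)
    (fun p hp => hd p.1.2 ⟨p.2, sub_eq_zero.mp hp⟩) (y := ⟨z, hz⟩) (y' := ⟨z', hz'⟩) h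

/-- The winding number vanishes in the unbounded component. -/
lemma hasWindingNumber_zero_of_mem_exteriorRegion {γ : Circle → ℂ} (hγ : Continuous γ) {z : ℂ}
    (hz : z ∈ exteriorRegion γ) : HasWindingNumber γ z 0 := by
  obtain ⟨C, hC⟩ := (isCompact_range hγ).isBounded.exists_norm_le
  -- The component is unbounded, so it contains a point farther out than the whole curve; about that
  -- point Rouché compares γ − z' with the constant −z'.
  obtain ⟨z', hz', hlt⟩ : ∃ z' ∈ connectedComponentIn (range γ)ᶜ z, C < ‖z'‖ := by
    by_contra! hcon
    exact hz.2 (isBounded_iff_forall_norm_le.mpr ⟨C, hcon⟩)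
  have hz0 : z' ≠ 0 := by
    rintro rfl
    have := hC _ (mem_range_self (1 : Circle))
    rw [norm_zero] at hlt
    exact absurd (norm_nonneg (γ 1)) (by linarith)
  have h' : HasWindingNumber γ z' 0 := by
    rw [← hasWindingNumber_sub]
    refine (hasWindingNumber_const (neg_ne_zero.mpr hz0)).of_norm_sub_lt continuous_const
      (by fun_prop) fun ξ => ?_
    rw [sub_sub, add_neg_cancel, sub_zero, norm_neg]
    exact (hC _ (mem_range_self ξ)).trans_lt hlt
  exact h'.of_isPreconnected hγ isPreconnected_connectedComponentIn
    (connectedComponentIn_subset _ _) hz' (mem_connectedComponentIn hz.1)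

lemma hasWindingNumber_zero_of_notMem_boundedRegion {γ : Circle → ℂ} (hγ : Continuous γ) {z : ℂ}
    (hz : z ∉ range γ) (hz' : z ∉ boundedRegion γ) : HasWindingNumber γ z 0 :=
  hasWindingNumber_zero_of_mem_exteriorRegion hγ ⟨hz, fun hb =>
    hz' ⟨_, ⟨z, hz, rfl, hb⟩, mem_connectedComponentIn hz⟩⟩

/-! ### Counting roots in the unit disk by winding numbers. -/

lemma hasWindingNumber_sub_const_of_norm_lt_one {l : ℂ} (hl : ‖l‖ < 1) :
    HasWindingNumber (fun ξ => (ξ : ℂ) - l) 0 1 :=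
  hasWindingNumber_coe.of_norm_sub_lt (by fun_prop) (by fun_prop) fun ξ => by simpa [Circle.norm_coe] using hl

lemma hasWindingNumber_sub_const_of_one_lt_norm {l : ℂ} (hl : 1 < ‖l‖) :
    HasWindingNumber (fun ξ => (ξ : ℂ) - l) 0 0 :=
  (hasWindingNumber_const (c := -l) (neg_ne_zero.mpr (norm_pos_iff.mp (by linarith)))
    ).of_norm_sub_lt (by fun_prop) (by fun_prop) fun ξ => by simpa [Circle.norm_coe] using hl

/-- The winding number of a polynomial counts its roots in the unit disk. -/
lemma hasWindingNumber_multiset_prod (s : Multiset ℂ) (hs : ∀ l ∈ s, ‖l‖ ≠ 1) :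
    HasWindingNumber (fun ξ => (s.map fun l => (ξ : ℂ) - l).prod) 0
      (s.countP fun l => ‖l‖ < 1 : ℕ) := by
  induction s using Multiset.induction_on with
  | empty => simpa using hasWindingNumber_const one_ne_zero
  | cons a s ih =>
    have ih := ih fun l hl => hs l (Multiset.mem_cons_of_mem hl)
    simp only [Multiset.map_cons, Multiset.prod_cons]
    rcases lt_or_gt_of_ne (hs a (Multiset.mem_cons_self a s)) with h | h
    · rw [Multiset.countP_cons_of_pos (p := fun l : ℂ => ‖l‖ < 1) s h]
      push_cast
      rw [add_comm]
      exact (hasWindingNumber_sub_const_of_norm_lt_one h).mul ih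
    · rw [Multiset.countP_cons_of_neg (p := fun l : ℂ => ‖l‖ < 1) s (not_lt.mpr h.le)]
      simpa using (hasWindingNumber_sub_const_of_one_lt_norm h).mul ih

/-! ### The local picture at a smooth point -/

/-- The closed curve `p`, normalized to pass at parameter `k` through the origin with tangent
vector `1`, is a graph over the real axis in the disk of radius `ρ`. -/
structure IsGraphNear (p : Circle → ℂ) (k ρ : ℝ) : Prop where
  continuous : Continuous p
  pos : 0 < ρ
  zero : p (Circle.exp k) = 0
  cone : ∀ ξ, ‖p ξ‖ < ρ → |(p ξ).im| ≤ |(p ξ).re|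
  inj : ∀ ξ ξ', ‖p ξ‖ < ρ → ‖p ξ'‖ < ρ → (p ξ).re = (p ξ').re → p ξ = p ξ'
  re_ne : ∀ ξ, ξ ≠ Circle.exp k → ‖p ξ‖ < ρ → (p ξ).re ≠ 0
  right : ∀ᶠ s : ℝ in 𝓝[>] k, 0 < (p (Circle.exp s)).re
  left : ∀ᶠ s : ℝ in 𝓝[<] k, (p (Circle.exp s)).re < 0

/-- Strict differentiability compares differences of the normalized curve with differences of the
parameter up to a factor 1/4, which gives the cone, injectivity and sign conditions near `k`. Since
the point is passed only once, compactness keeps the rest of the curve out of a small disk. -/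
lemma IsSmoothPoint.exists_isGraphNear {γ : Circle → ℂ} (hγ : Continuous γ) {k : ℝ}
    (h : IsSmoothPoint γ k) :
    ∃ ρ, IsGraphNear (fun ξ => (γ ξ - γ (Circle.exp k)) / tangent γ k) k ρ := by
  obtain ⟨hC, hv, honce⟩ := h
  set v := tangent γ k with hvdef
  set p : Circle → ℂ := fun ξ => (γ ξ - γ (Circle.exp k)) / v with hp
  have hpc : Continuous p := by fun_prop
  have hd : HasStrictDerivAt (fun s : ℝ => p (Circle.exp s)) 1 k := by
    have h1 := hC.hasStrictDerivAt one_ne_zero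
    have h2 : HasStrictDerivAt (fun s : ℝ => γ (Circle.exp s) - γ (Circle.exp k)) v k :=
      h1.sub_const _
    have h3 := h2.const_mul v⁻¹
    rw [inv_mul_cancel₀ hv] at h3
    simpa only [hp, div_eq_inv_mul] using h3
  have hlo := (hasStrictDerivAt_iff_hasStrictFDerivAt.mp hd).isLittleO.bound
    (show (0 : ℝ) < 1 / 4 by norm_num)
  obtain ⟨η, hη, hball⟩ := Metric.eventually_nhds_iff_ball.mp hlo
  have hest : ∀ s ∈ Metric.ball k η, ∀ s' ∈ Metric.ball k η,
      ‖p (Circle.exp s) - p (Circle.exp s') - (s - s' : ℝ)‖ ≤ 1 / 4 * |s - s'| := by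
    intro s hs s' hs'
    have := hball (s, s') (by
      rw [← ball_prod_same]
      exact ⟨hs, hs'⟩)
    simpa using this
  have hre : ∀ s ∈ Metric.ball k η, ∀ s' ∈ Metric.ball k η,
      |(p (Circle.exp s)).re - (p (Circle.exp s')).re - (s - s')| ≤ 1 / 4 * |s - s'| := by
    intro s hs s' hs'
    have h1 := (Complex.abs_re_le_norm _).trans (hest s hs s' hs')
    simpa using h1
  have him : ∀ s ∈ Metric.ball k η, ∀ s' ∈ Metric.ball k η,
      |(p (Circle.exp s)).im - (p (Circle.exp s')).im| ≤ 1 / 4 * |s - s'| := by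
    intro s hs s' hs'
    have h1 := (Complex.abs_im_le_norm _).trans (hest s hs s' hs')
    simpa using h1
  have hk : k ∈ Metric.ball k η := Metric.mem_ball_self hη
  have hp0 : p (Circle.exp k) = 0 := by simp [hp]
  have hopen : IsOpen (Circle.exp '' Metric.ball k η) :=
    isLocalHomeomorph_circleExp.isOpenMap _ Metric.isOpen_ball
  -- `ρ` is a positive lower bound for `‖p‖` off the arc of parameters near `k`, so every curve
  -- point in the disk of radius `ρ` comes from that arc.
  obtain ⟨ρ, hρ, hρ'⟩ := hopen.isClosed_compl.isCompact.exists_forall_le' (a := (0 : ℝ))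
    (f := fun ξ => ‖p ξ‖) hpc.norm.continuousOn (by
      intro ξ hξ
      refine norm_pos_iff.mpr fun h0 => hξ ?_
      rw [honce ξ (by simpa [hp, hv, sub_eq_zero] using h0)]
      exact mem_image_of_mem _ hk)
  have hloc : ∀ ξ, ‖p ξ‖ < ρ → ∃ s ∈ Metric.ball k η, Circle.exp s = ξ := by
    intro ξ hξ
    by_contra hcon
    exact absurd (hρ' ξ hcon) (not_le.mpr hξ)
  have hpos : ∀ s ∈ Metric.ball k η, k < s → 0 < (p (Circle.exp s)).re := by
    intro s hs hlt
    have h1 := hre s hs k hk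
    rw [hp0, Complex.zero_re, sub_zero, abs_of_pos (sub_pos.mpr hlt)] at h1
    linarith [(abs_le.mp h1).1]
  have hneg : ∀ s ∈ Metric.ball k η, s < k → (p (Circle.exp s)).re < 0 := by
    intro s hs hlt
    have h1 := hre s hs k hk
    rw [hp0, Complex.zero_re, sub_zero, abs_of_neg (sub_neg.mpr hlt)] at h1
    linarith [(abs_le.mp h1).2]
  refine ⟨ρ, hpc, hρ, hp0, ?_, ?_, ?_, ?_, ?_⟩
  · intro ξ hξ
    obtain ⟨s, hs, rfl⟩ := hloc ξ hξ
    have h1 := hre s hs k hk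
    have h2 := him s hs k hk
    rw [hp0, Complex.zero_re, sub_zero] at h1
    rw [hp0, Complex.zero_im, sub_zero] at h2
    -- The real part is at least 3/4 of `|s - k|` in absolute value, the imaginary part at most 1/4
    -- of it.
    have h3 := abs_sub_abs_le_abs_sub (s - k) (p (Circle.exp s)).re
    rw [abs_sub_comm] at h1
    linarith [abs_nonneg (s - k)]
  · intro ξ ξ' hξ hξ' heq
    obtain ⟨s, hs, rfl⟩ := hloc ξ hξ
    obtain ⟨s', hs', rfl⟩ := hloc ξ' hξ'
    have h1 := hre s hs s' hs'
    rw [heq, sub_self, zero_sub, abs_neg] at h1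
    have h2 : |s - s'| = 0 := le_antisymm (by linarith [abs_nonneg (s - s')]) (abs_nonneg _)
    rw [sub_eq_zero.mp (abs_eq_zero.mp h2)]
  · intro ξ hne hξ
    obtain ⟨s, hs, rfl⟩ := hloc ξ hξ
    rcases lt_trichotomy s k with h | rfl | h
    · exact (hneg s hs h).ne
    · exact absurd rfl hne
    · exact (hpos s hs h).ne'
  · filter_upwards [self_mem_nhdsWithin, mem_nhdsWithin_of_mem_nhds (Metric.ball_mem_nhds k hη)]
      with s h1 h2 using hpos s h2 h1
  · filter_upwards [self_mem_nhdsWithin, mem_nhdsWithin_of_mem_nhds (Metric.ball_mem_nhds k hη)]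
      with s h1 h2 using hneg s h2 h1

/-- The formulas show that the quotient can lie on the cut of the principal logarithm only if `p` is
on the imaginary axis with `‖p‖ ≤ |τ|`, and that for `τ > 0` its imaginary part has the sign
opposite to that of `p.re`. -/
lemma cayley_re_im (p : ℂ) (τ : ℝ) :
    ((p - τ * Complex.I) / (p + τ * Complex.I)).re =
        (p.re ^ 2 + p.im ^ 2 - τ ^ 2) / Complex.normSq (p + τ * Complex.I) ∧
      ((p - τ * Complex.I) / (p + τ * Complex.I)).im =
        -(2 * p.re * τ) / Complex.normSq (p + τ * Complex.I) := by
  constructor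
  · rw [Complex.div_re, ← add_div]
    congr 1
    simp
    ring
  · rw [Complex.div_im, ← sub_div]
    congr 1
    simp
    ring

namespace IsGraphNear

variable {p : Circle → ℂ} {k ρ τ : ℝ}

/-- The segment `[-iτ, iτ]` meets the curve only in the origin. -/
lemma re_ne_or_lt_norm (h : IsGraphNear p k ρ) (hτ : τ < ρ) {ξ : Circle}
    (hξ : ξ ≠ Circle.exp k) : (p ξ).re ≠ 0 ∨ τ < ‖p ξ‖ := by
  by_cases hlt : ‖p ξ‖ < ρ
  · exact Or.inl (h.re_ne ξ hξ hlt)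
  · exact Or.inr (by linarith)

lemma ne_mul_I (h : IsGraphNear p k ρ) (hτ : |τ| < ρ) (h0 : τ ≠ 0) (ξ : Circle) :
    p ξ ≠ τ * Complex.I := by
  intro heq
  by_cases hξ : ξ = Circle.exp k
  · rw [hξ, h.zero] at heq
    simp [h0] at heq
  · rcases h.re_ne_or_lt_norm hτ hξ with h1 | h1
    · exact h1 (by simp [heq])
    · simp [heq] at h1

/-- The Möbius map (p − iτ)/(p + iτ) sends the open segment from −iτ to iτ onto the negative real
axis. The curve meets this segment only at parameter `k`, so elsewhere the principal logarithm is
available. -/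
lemma cayley_mem_slitPlane (h : IsGraphNear p k ρ) (h0 : 0 < τ) (hτ : τ < ρ) {ξ : Circle}
    (hξ : ξ ≠ Circle.exp k) :
    (p ξ - τ * Complex.I) / (p ξ + τ * Complex.I) ∈ Complex.slitPlane := by
  have hne : p ξ + τ * Complex.I ≠ 0 := by
    have := h.ne_mul_I (τ := -τ) (by rwa [abs_neg, abs_of_pos h0]) (by linarith) ξ
    intro h1
    exact this (by push_cast; linear_combination h1)
  have hpos := Complex.normSq_pos.mpr hne
  rw [Complex.mem_slitPlane_iff, (cayley_re_im _ _).1, (cayley_re_im _ _).2]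
  by_cases hre : (p ξ).re = 0
  · left
    have h1 := (h.re_ne_or_lt_norm hτ hξ).resolve_left (not_not.mpr hre)
    have h2 : τ ^ 2 < ‖p ξ‖ ^ 2 := by gcongr
    rw [← Complex.normSq_eq_norm_sq, Complex.normSq_apply] at h2
    exact div_pos (by nlinarith) hpos
  · right
    exact div_ne_zero (neg_ne_zero.mpr (by positivity)) hpos.ne'

/-- The curve passes once around `iτ` relative to `-iτ`. -/
lemma hasWindingNumber_cayley (h : IsGraphNear p k ρ) (h0 : 0 < τ) (hτ : τ < ρ) :
    HasWindingNumber (fun ξ => (p ξ - τ * Complex.I) / (p ξ + τ * Complex.I)) 0 1 := by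
  set q : Circle → ℂ := fun ξ => (p ξ - τ * Complex.I) / (p ξ + τ * Complex.I) with hq
  have habs : |τ| < ρ := by rwa [abs_of_pos h0]
  have hpc := h.continuous
  have hnum : ∀ ξ, p ξ - τ * Complex.I ≠ 0 := fun ξ => sub_ne_zero.mpr (h.ne_mul_I habs h0.ne' ξ)
  have hden : ∀ ξ, p ξ + τ * Complex.I ≠ 0 := fun ξ h1 => by
    refine h.ne_mul_I (τ := -τ) (by rwa [abs_neg]) (by linarith) ξ ?_
    push_cast
    linear_combination h1
  have hqc : Continuous q := by
    refine Continuous.div (by fun_prop) (by fun_prop) hden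
  have hqk : q (Circle.exp k) = -1 := by
    have : (τ * Complex.I : ℂ) ≠ 0 := by simp [h0.ne']
    simp only [hq, h.zero, zero_sub, zero_add, neg_div, div_self this]
  obtain ⟨-, θ, hθ, he, -⟩ :=
    exists_hasWindingNumber hqc fun ξ => div_ne_zero (hnum ξ) (hden ξ)
  have hπ := Real.pi_pos
  have hexp : ∀ s ∈ Ioo k (k + 2 * Real.pi), Circle.exp s ≠ Circle.exp k := by
    intro s hs heq
    obtain ⟨j, hj⟩ := Circle.exp_eq_exp.mp heq
    have h1 : (0 : ℝ) < j := by
      by_contra! hle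
      nlinarith [hs.1]
    have h2 : (j : ℝ) < 1 := by
      by_contra! hle
      nlinarith [hs.2]
    have h3 : 0 < j := by exact_mod_cast h1
    have h4 : j < 1 := by exact_mod_cast h2
    omega
  have hslit : ∀ s ∈ Ioo k (k + 2 * Real.pi), q (Circle.exp s) ∈ Complex.slitPlane :=
    fun s hs => h.cayley_mem_slitPlane h0 hτ (hexp s hs)
  have hqs : Continuous fun s : ℝ => q (Circle.exp s) := hqc.comp Circle.exp.continuous
  -- On the open turn any continuous logarithm is the principal one plus a constant; the increment
  -- is therefore the difference of the one-sided limits at the cut.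
  have hconst : ∃ c, ∀ s ∈ Ioo k (k + 2 * Real.pi), θ s = Complex.log (q (Circle.exp s)) + c := by
    have hmid : k + Real.pi ∈ Ioo k (k + 2 * Real.pi) := ⟨by linarith, by linarith⟩
    refine ⟨θ (k + Real.pi) - Complex.log (q (Circle.exp (k + Real.pi))), fun s hs => ?_⟩
    have := eq_of_exp_eq_one isPreconnected_Ioo
      (θ := fun s => θ s - Complex.log (q (Circle.exp s)))
      (hθ.continuousOn.sub (hqs.continuousOn.clog hslit)) (fun s hs => by
        have hs0 := Complex.slitPlane_ne_zero (hslit s hs)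
        rw [Complex.exp_sub, he, sub_zero, Complex.exp_log hs0, div_self hs0]) hs hmid
    linear_combination this
  obtain ⟨c, hc⟩ := hconst
  have him : ∀ s : ℝ, (q (Circle.exp s)).im =
      -(2 * (p (Circle.exp s)).re * τ) / Complex.normSq (p (Circle.exp s) + τ * Complex.I) :=
    fun s => (cayley_re_im _ _).2
  have hnsq : ∀ s : ℝ, 0 < Complex.normSq (p (Circle.exp s) + τ * Complex.I) :=
    fun s => Complex.normSq_pos.mpr (hden _)
  -- Just after `k` the curve has positive real part, so `q` lies below the cut near −1 and the
  -- principal logarithm tends to −πi.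
  have hθk : θ k = -(Real.pi * Complex.I) + c := by
    have h1 : Tendsto (fun s : ℝ => q (Circle.exp s)) (𝓝[>] k) (𝓝[{z : ℂ | z.im < 0}] (-1)) := by
      refine tendsto_nhdsWithin_iff.mpr ⟨?_, ?_⟩
      · rw [← hqk]
        exact hqs.continuousAt.tendsto.mono_left nhdsWithin_le_nhds
      · filter_upwards [h.right] with s hs
        rw [him]
        exact div_neg_of_neg_of_pos (by nlinarith [mul_pos hs h0]) (hnsq s)
    have h2 := (Complex.tendsto_log_nhdsWithin_im_neg_of_re_neg_of_im_zero (z := -1)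
      (by simp) (by simp)).comp h1
    have h3 : Tendsto θ (𝓝[>] k) (𝓝 (Real.log ‖(-1 : ℂ)‖ - Real.pi * Complex.I + c)) := by
      refine (h2.add_const c).congr' ?_
      filter_upwards [Ioo_mem_nhdsGT (show k < k + 2 * Real.pi by linarith)] with s hs
      exact (hc s hs).symm
    have h4 := tendsto_nhds_unique (hθ.continuousAt.tendsto.mono_left nhdsWithin_le_nhds) h3
    simpa using h4
  -- Just before the turn closes, the real part of `p` is negative and `q` approaches −1 from the
  -- upper side, where the limit is +πi.
  have hθk' : θ (k + 2 * Real.pi) = Real.pi * Complex.I + c := by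
    have h1 : Tendsto (fun s : ℝ => q (Circle.exp s)) (𝓝[<] (k + 2 * Real.pi))
        (𝓝[{z : ℂ | 0 ≤ z.im}] (-1)) := by
      refine tendsto_nhdsWithin_iff.mpr ⟨?_, ?_⟩
      · rw [← hqk, ← Circle.exp_add_two_pi]
        exact hqs.continuousAt.tendsto.mono_left nhdsWithin_le_nhds
      · have hsub : Tendsto (fun s : ℝ => s - 2 * Real.pi) (𝓝[<] (k + 2 * Real.pi)) (𝓝[<] k) := by
          refine tendsto_nhdsWithin_iff.mpr ⟨?_, ?_⟩
          · have : Tendsto (fun s : ℝ => s - 2 * Real.pi) (𝓝 (k + 2 * Real.pi))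
                (𝓝 (k + 2 * Real.pi - 2 * Real.pi)) :=
              (continuous_id.sub continuous_const).continuousAt
            rw [add_sub_cancel_right] at this
            exact this.mono_left nhdsWithin_le_nhds
          · filter_upwards [self_mem_nhdsWithin] with s hs
            exact sub_lt_iff_lt_add.mpr (mem_Iio.mp hs)
        filter_upwards [hsub.eventually h.left] with s hs
        rw [Circle.exp_sub_two_pi] at hs
        rw [him]
        exact div_nonneg (by nlinarith [mul_neg_of_neg_of_pos hs h0]) (hnsq s).le
    have h2 := (Complex.continuousWithinAt_log_of_re_neg_of_im_zero (z := -1)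
      (by simp) (by simp)).tendsto.comp h1
    have h3 : Tendsto θ (𝓝[<] (k + 2 * Real.pi)) (𝓝 (Complex.log (-1) + c)) := by
      refine (h2.add_const c).congr' ?_
      filter_upwards [Ioo_mem_nhdsLT (show k < k + 2 * Real.pi by linarith)] with s hs
      exact (hc s hs).symm
    have h4 := tendsto_nhds_unique (hθ.continuousAt.tendsto.mono_left nhdsWithin_le_nhds) h3
    rwa [Complex.log_neg_one] at h4
  refine ⟨θ, hθ, he, ?_⟩
  -- `HasWindingNumber` measures the increment from 0; here it is moved to the base point `k`.
  have := log_increment_eq (f := q) hθ (by simpa using he) 0 k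
  rw [zero_add] at this
  rw [this, hθk, hθk']
  push_cast
  ring

/-- The jump of the winding number across the curve. -/
lemma hasWindingNumber_add_one (h : IsGraphNear p k ρ) (h0 : 0 < τ) (hτ : τ < ρ) {m : ℤ}
    (hm : HasWindingNumber p (-(τ * Complex.I)) m) :
    HasWindingNumber p (τ * Complex.I) (m + 1) := by
  rw [← hasWindingNumber_sub] at hm ⊢
  have h1 := hm.mul (h.hasWindingNumber_cayley h0 hτ)
  have hden := hm.ne_zero
  simp only [sub_neg_eq_add] at h1 hden
  simpa only [mul_div_cancel₀ _ (hden _)] using h1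

/-- Points off the curve and close to the origin can be joined off the curve with the upper or the
lower half of the imaginary axis. -/
lemma exists_joinedIn (h : IsGraphNear p k ρ) {w : ℂ} (hw : w ∉ range p) (hre : |w.re| < ρ / 4)
    (him : |w.im| < ρ / 4) :
    ∃ ε : ℝ, (ε = 1 ∨ ε = -1) ∧ ∀ τ, 0 < τ → τ ≤ ρ / 2 →
      JoinedIn (range p)ᶜ w (ε * τ * Complex.I) := by
  have hρ := h.pos
  have hnorm : ∀ z : ℂ, |z.re| ≤ |w.re| → |z.im| ≤ ρ / 2 → ‖z‖ < ρ := fun z h1 h2 => by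
    linarith [Complex.norm_le_abs_re_add_abs_im z]
  have hseg : ∀ a b : ℂ, (∀ t : ℝ, 0 ≤ t → t ≤ 1 → a + t * (b - a) ∉ range p) →
      JoinedIn (range p)ᶜ a b := by
    intro a b hab
    refine JoinedIn.of_segment_subset ?_
    rw [segment_eq_image']
    rintro _ ⟨t, ht, rfl⟩
    simpa using hab t ht.1 ht.2
  -- `ε` is the vertical direction leading away from the curve: downward if some curve point lies
  -- above `w` on its vertical line, upward otherwise. By the graph property that line carries at
  -- most one curve point within the disk.
  obtain ⟨ε, hε, hvert⟩ : ∃ ε : ℝ, (ε = 1 ∨ ε = -1) ∧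
      ∀ ξ, ‖p ξ‖ < ρ → (p ξ).re = w.re → ε * (p ξ).im < ε * w.im := by
    by_cases hex : ∃ ξ, ‖p ξ‖ < ρ ∧ (p ξ).re = w.re ∧ w.im < (p ξ).im
    · obtain ⟨ξ₀, h1, h2, h3⟩ := hex
      refine ⟨-1, Or.inr rfl, fun ξ h4 h5 => ?_⟩
      rw [h.inj ξ ξ₀ h4 h1 (h5.trans h2.symm)]
      linarith
    · push Not at hex
      refine ⟨1, Or.inl rfl, fun ξ h4 h5 => ?_⟩
      have h6 := hex ξ h4 h5
      have h7 : (p ξ).im ≠ w.im := fun h7 => hw ⟨ξ, Complex.ext h5 h7⟩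
      rw [one_mul, one_mul]
      exact lt_of_le_of_ne h6 h7
  have hεsq : ε * ε = 1 := by rcases hε with rfl | rfl <;> norm_num
  have hεabs : |ε| = 1 := by rcases hε with rfl | rfl <;> norm_num
  have hεim : ε * w.im ≤ ρ / 4 := by
    calc ε * w.im ≤ |ε * w.im| := le_abs_self _
      _ ≤ ρ / 4 := by rw [abs_mul, hεabs, one_mul]; exact him.le
  refine ⟨ε, hε, fun τ hτ hτρ => ?_⟩
  -- The path goes vertically from `w` to height `ερ/2`, then horizontally to the imaginary axis,
  -- then along the axis. The three legs avoid the curve by the choice of `ε`, by the cone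
  -- condition, and because the axis meets the curve only at the origin inside the disk.
  set u : ℂ := ⟨w.re, ε * (ρ / 2)⟩ with hu
  set u' : ℂ := ⟨0, ε * (ρ / 2)⟩ with hu'
  have hlo := (abs_lt.mp him).1
  have hhi := (abs_lt.mp him).2
  have j1 : JoinedIn (range p)ᶜ w u := by
    refine hseg _ _ fun t ht0 ht1 => ?_
    rintro ⟨ξ, hξ⟩
    have hr : (p ξ).re = w.re := by simp [hξ, hu]
    have hi : (p ξ).im = w.im + t * (ε * (ρ / 2) - w.im) := by simp [hξ, hu]
    have hlt : ‖p ξ‖ < ρ := by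
      refine hnorm _ (by rw [hr]) ?_
      rw [hi, abs_le]
      rcases hε with rfl | rfl <;> constructor <;> nlinarith
    have h2 := hvert ξ hlt hr
    rw [hi] at h2
    have h3 : ε * (w.im + t * (ε * (ρ / 2) - w.im)) =
        ε * w.im + t * (ρ / 2 - ε * w.im) := by linear_combination t * (ρ / 2) * hεsq
    rw [h3] at h2
    nlinarith [mul_nonneg ht0 (show 0 ≤ ρ / 2 - ε * w.im by linarith)]
  have j2 : JoinedIn (range p)ᶜ u u' := by
    refine hseg _ _ fun t ht0 ht1 => ?_
    rintro ⟨ξ, hξ⟩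
    have hr : (p ξ).re = (1 - t) * w.re := by simp [hξ, hu, hu']; ring
    have hi : (p ξ).im = ε * (ρ / 2) := by simp [hξ, hu, hu']
    have habs : |(p ξ).re| ≤ |w.re| := by
      rw [hr, abs_mul, abs_of_nonneg (by linarith)]
      exact mul_le_of_le_one_left (abs_nonneg _) (by linarith)
    have habs' : |(p ξ).im| = ρ / 2 := by rw [hi, abs_mul, hεabs, one_mul, abs_of_pos (by linarith)]
    have := h.cone ξ (hnorm _ habs habs'.le)
    linarith
  have j3 : JoinedIn (range p)ᶜ u' (ε * τ * Complex.I) := by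
    refine hseg _ _ fun t ht0 ht1 => ?_
    rintro ⟨ξ, hξ⟩
    set r : ℝ := ρ / 2 + t * (τ - ρ / 2) with hr
    have hr0 : 0 < r := by nlinarith
    have hr1 : r < ρ := by nlinarith
    refine h.ne_mul_I (τ := ε * r) (by rw [abs_mul, hεabs, one_mul, abs_of_pos hr0]; exact hr1)
      (mul_ne_zero (by rintro rfl; simp at hεabs) hr0.ne') ξ ?_
    rw [hξ]
    apply Complex.ext <;> simp [hu', hr]
    ring
  exact (j1.trans j2).trans j3

end IsGraphNear

/-! ### From the local jump to the winding number in a bounded component. -/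

lemma hasWindingNumber_affine {γ : Circle → ℂ} {ζ v c : ℂ} (hv : v ≠ 0) {m : ℤ} :
    HasWindingNumber (fun ξ => (γ ξ - ζ) / v) c m ↔ HasWindingNumber γ (ζ + v * c) m := by
  rw [← hasWindingNumber_sub, ← hasWindingNumber_sub (γ := γ)]
  constructor <;> intro h
  · have := (hasWindingNumber_const hv).mul h
    rw [zero_add] at this
    convert this using 2
    field_simp
    ring
  · have := (hasWindingNumber_const (inv_ne_zero hv)).mul h
    rw [zero_add] at this
    convert this using 2
    field_simp
    ring

/-- The quotient of `ν` by the normalized tangent has modulus 1, and orthogonality makes its real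
part vanish, so it is ±i. -/
lemma eq_of_norm_eq_one_of_inner_eq_zero {v ν : ℂ} (hv : v ≠ 0) (hν : ‖ν‖ = 1)
    (h : inner ℝ v ν = 0) : ∃ σ : ℤ, (σ = 1 ∨ σ = -1) ∧ ν = -σ * Complex.I * (v / ‖v‖) := by
  have hn : (‖v‖ : ℂ) ≠ 0 := by simpa using hv
  set q : ℂ := ν / (v / ‖v‖) with hq
  have hνq : ν = q * (v / ‖v‖) := (div_mul_cancel₀ _ (div_ne_zero hv hn)).symm
  have hqn : ‖q‖ = 1 := by
    rw [hq, norm_div, hν, norm_div, Complex.norm_real, norm_norm,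
      div_self (norm_ne_zero_iff.mpr hv), div_one]
  have hqre : q.re = 0 := by
    rw [Complex.inner, hνq] at h
    have h2 : (starRingEnd ℂ) v * (q * (v / ‖v‖)) = (‖v‖ : ℝ) * q := by
      have : (starRingEnd ℂ) v * v = (‖v‖ : ℂ) ^ 2 := by
        rw [mul_comm, Complex.mul_conj, Complex.normSq_eq_norm_sq]
        push_cast
        ring
      field_simp
      linear_combination q * this
    rw [mul_comm, h2, Complex.re_ofReal_mul] at h
    exact (mul_eq_zero.mp h).resolve_left (norm_ne_zero_iff.mpr hv)
  have him : q.im = 1 ∨ q.im = -1 := by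
    have h1 : ‖q‖ ^ 2 = 1 := by rw [hqn, one_pow]
    rw [← Complex.normSq_eq_norm_sq, Complex.normSq_apply, hqre] at h1
    exact mul_self_eq_one_iff.mp (by linarith)
  rcases him with h1 | h1
  · refine ⟨-1, Or.inr rfl, ?_⟩
    have : q = Complex.I := Complex.ext (by simp [hqre]) (by simp [h1])
    rw [hνq, this]
    simp
  · refine ⟨1, Or.inl rfl, ?_⟩
    have : q = -Complex.I := Complex.ext (by simp [hqre]) (by simp [h1])
    rw [hνq, this]
    simp

/-- The winding number about the points of a bounded component that is adjacent, at a smooth point,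
to the exterior region. -/
theorem hasWindingNumber_of_isBoundedComponent {γ : Circle → ℂ} (hγ : Continuous γ) {D : Set ℂ}
    (hD : IsBoundedComponent γ D) {k : ℝ} (hk : γ (Circle.exp k) ∈ frontier D)
    (hs : IsSmoothPoint γ k) {ν : ℂ} (hν : IsOutwardUnitNormal γ k ν) {σ : ℤ}
    (hσ : σ = 1 ∨ σ = -1) (hνσ : ν = -σ * Complex.I * (tangent γ k / ‖tangent γ k‖)) {w : ℂ}
    (hw : w ∈ D) : HasWindingNumber γ w σ := by
  obtain ⟨w₀, -, rfl, hbdd⟩ := hD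
  obtain ⟨ρ, hρ⟩ := hs.exists_isGraphNear hγ
  set ζ := γ (Circle.exp k) with hζ
  set v := tangent γ k with hvdef
  have hv : v ≠ 0 := hs.2.1
  have hvn : (‖v‖ : ℂ) ≠ 0 := by simpa using hv
  have hvpos : 0 < ‖v‖ := norm_pos_iff.mpr hv
  set p : Circle → ℂ := fun ξ => (γ ξ - ζ) / v with hp
  have hγp : ∀ ξ, γ ξ = ζ + v * p ξ := fun ξ => by
    simp only [hp]
    field_simp
    ring
  have hrange : ∀ c, ζ + v * c ∈ (range γ)ᶜ ↔ c ∈ (range p)ᶜ := by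
    intro c
    refine not_congr (exists_congr fun ξ => ?_)
    rw [hγp, add_right_inj, mul_right_inj' hv]
  have hρ0 := hρ.pos
  obtain ⟨c, hcD, hcre, hcim⟩ : ∃ c, ζ + v * c ∈ connectedComponentIn (range γ)ᶜ w₀ ∧
      |c.re| < ρ / 4 ∧ |c.im| < ρ / 4 := by
    have hcl := frontier_subset_closure hk
    obtain ⟨z, hz, hdist⟩ := Metric.mem_closure_iff.mp hcl (‖v‖ * (ρ / 4)) (by positivity)
    have hlt : ‖(z - ζ) / v‖ < ρ / 4 := by
      rw [norm_div, div_lt_iff₀ hvpos, mul_comm, ← dist_eq_norm, dist_comm]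
      exact hdist
    refine ⟨(z - ζ) / v, ?_, (Complex.abs_re_le_norm _).trans_lt hlt,
      (Complex.abs_im_le_norm _).trans_lt hlt⟩
    rwa [mul_div_cancel₀ _ hv, add_sub_cancel]
  have hcc := connectedComponentIn_subset _ _ hcD
  obtain ⟨ε, hε, hjoin⟩ := hρ.exists_joinedIn ((hrange c).mp hcc) hcre hcim
  -- In normalized coordinates the outward normal points along −σi, and dividing by `v` rescales its
  -- length `r` to `r / ‖v‖`.
  obtain ⟨t, ht0, htρ, hext⟩ : ∃ t, 0 < t ∧ t ≤ ρ / 2 ∧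
      ζ + v * (-(σ * t * Complex.I)) ∈ exteriorRegion γ := by
    have h1 := hν.2.2
    obtain ⟨r, hr, hr'⟩ := (h1.and (Ioo_mem_nhdsGT (show 0 < ‖v‖ * (ρ / 2) by positivity))).exists
    refine ⟨r / ‖v‖, div_pos hr'.1 hvpos, ?_, ?_⟩
    · rw [div_le_iff₀ hvpos, mul_comm]
      exact hr'.2.le
    · convert hr using 2
      rw [hνσ]
      push_cast
      field_simp
  have hjoinγ : ∀ a b, JoinedIn (range p)ᶜ a b → JoinedIn (range γ)ᶜ (ζ + v * a) (ζ + v * b) := by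
    rintro a b ⟨π, hπ⟩
    exact ⟨π.map (f := fun z => ζ + v * z) (by fun_prop), fun t => (hrange _).mpr (hπ t)⟩
  have hside : ζ + v * (ε * t * Complex.I) ∈ connectedComponentIn (range γ)ᶜ w₀ := by
    have hj := hjoinγ _ _ (hjoin t ht0 htρ)
    have hpre : IsPreconnected (range hj.somePath) := isPreconnected_range hj.somePath.continuous
    rw [connectedComponentIn_eq hcD]
    refine hpre.subset_connectedComponentIn (x := ζ + v * c) ⟨0, by simp⟩ ?_ ⟨1, by simp⟩
    rintro _ ⟨s, rfl⟩
    exact hj.somePath_mem s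
  -- The half-axis reached from the bounded component cannot be the outward one, since its point at
  -- height `t` would then lie in both the bounded component and the exterior.
  have hεσ : ε = σ := by
    by_contra hne
    have hεσ' : ε = -σ := by
      rcases hε with rfl | rfl <;> rcases hσ with rfl | rfl <;>
        simp at hne ⊢
    apply hext.2
    have : ζ + v * (-(σ * t * Complex.I)) = ζ + v * (ε * t * Complex.I) := by
      rw [hεσ']
      push_cast
      ring
    rw [this, ← connectedComponentIn_eq hside]
    exact hbdd
  have hW0 : HasWindingNumber p (-(σ * t * Complex.I)) 0 :=
    (hasWindingNumber_affine hv).mpr (hasWindingNumber_zero_of_mem_exteriorRegion hγ hext)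
  have hW1 : HasWindingNumber p (σ * t * Complex.I) σ := by
    rcases hσ with rfl | rfl
    · have := hρ.hasWindingNumber_add_one ht0 (by linarith) (m := 0) (by simpa using hW0)
      simpa using this
    -- For σ = −1 the exterior point is the upper one, so the jump is read backwards: m + 1 = 0.
    · obtain ⟨m, hm⟩ := exists_hasWindingNumber (f := fun ξ => p ξ - -(t * Complex.I))
        (hρ.continuous.sub continuous_const) fun ξ => by
          have := hρ.ne_mul_I (τ := -t) (by rw [abs_neg, abs_of_pos ht0]; linarith)
            (by linarith) ξ
          rw [sub_ne_zero]
          simpa using this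
      rw [hasWindingNumber_sub] at hm
      have h1 := hρ.hasWindingNumber_add_one ht0 (by linarith) hm
      have h2 : HasWindingNumber p (t * Complex.I) 0 := by simpa using hW0
      rw [← hasWindingNumber_sub] at h1 h2
      have h3 := h1.unique h2
      have h4 : m = -1 := by omega
      rw [h4] at hm
      simpa using hm
  have hW2 := (hasWindingNumber_affine (γ := γ) (ζ := ζ) hv).mp hW1
  rw [hεσ] at hside
  exact hW2.of_isPreconnected hγ isPreconnected_connectedComponentIn
    (connectedComponentIn_subset _ _) (by simpa using hside) hw

/-! ### Factoring zeros out of families of entire functions -/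

/-- An entire function is divisible by linear factors whose zeros it has with multiplicity. -/
lemma exists_eq_prod_mul {κ : Type*} (F : Finset κ) (a : κ → ℂ) {f : ℂ → ℂ}
    (hf : Differentiable ℂ f)
    (hle : ∀ w, (Set.encard {i | i ∈ F ∧ a i = w}) ≤ analyticOrderAt f w) :
    ∃ g : ℂ → ℂ, Differentiable ℂ g ∧ (∀ w, f w = (∏ i ∈ F, (w - a i)) * g w) ∧
      ∀ w, analyticOrderAt f w = Set.encard {i | i ∈ F ∧ a i = w} + analyticOrderAt g w := by
  classical
  induction F using Finset.induction_on generalizing f with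
  | empty => exact ⟨f, hf, by simp, by simp⟩
  | insert j F hj ih =>
    have hcard : ∀ w, Set.encard {i | i ∈ insert j F ∧ a i = w} =
        (if a j = w then 1 else 0) + Set.encard {i | i ∈ F ∧ a i = w} := by
      intro w
      split_ifs with h
      · have : {i | i ∈ insert j F ∧ a i = w} = insert j {i | i ∈ F ∧ a i = w} := by
          ext i
          simp only [Finset.mem_insert, mem_insert_iff, mem_ofPred_eq]
          constructor
          · rintro ⟨rfl | h1, h2⟩
            · exact Or.inl rfl
            · exact Or.inr ⟨h1, h2⟩
          · rintro (rfl | h1)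
            · exact ⟨Or.inl rfl, h⟩
            · exact ⟨Or.inr h1.1, h1.2⟩
        rw [this, Set.encard_insert_of_notMem (by simp [hj]), add_comm]
      · rw [zero_add]
        congr 1
        ext i
        simp only [Finset.mem_insert, mem_ofPred_eq]
        constructor
        · rintro ⟨rfl | h1, h2⟩
          · exact absurd h2 h
          · exact ⟨h1, h2⟩
        · exact fun h1 => ⟨Or.inr h1.1, h1.2⟩
    have hfa : f (a j) = 0 := by
      refine apply_eq_zero_of_analyticOrderAt_ne_zero fun h0 => ?_
      have := hle (a j)
      rw [h0, hcard, if_pos rfl] at this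
      simp at this
    -- Dividing out one zero leaves a removable singularity, so the divided difference is again
    -- entire.
    have hd : Differentiable ℂ (dslope f (a j)) := by
      rw [← differentiableOn_univ]
      exact (Complex.differentiableOn_dslope univ_mem).mpr hf.differentiableOn
    have hfd : f = (fun w => w - a j) * dslope f (a j) := by
      funext w
      have := sub_smul_dslope f (a j) w
      rw [hfa, sub_zero, smul_eq_mul] at this
      exact this.symm
    have hord : ∀ w, analyticOrderAt f w =
        (if a j = w then 1 else 0) + analyticOrderAt (dslope f (a j)) w := by
      intro w
      conv_lhs => rw [hfd]
      rw [analyticOrderAt_mul (by fun_prop) (hd.analyticAt w)]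
      congr 1
      split_ifs with h
      · rw [← h]
        exact analyticOrderAt_id_sub_const_self
      · exact analyticOrderAt_id_sub_const_of_ne (Ne.symm h)
    obtain ⟨g, hg, hfg, hgo⟩ := ih hd fun w => by
      have := hle w
      rw [hcard, hord] at this
      split_ifs at this
      · exact (ENat.add_le_add_iff_left (by simp)).mp this
      · simpa using this
    refine ⟨g, hg, fun w => ?_, fun w => ?_⟩
    · rw [Finset.prod_insert hj, mul_assoc, ← hfg]
      exact congrFun hfd w
    · rw [hord, hgo, hcard, add_assoc]

/-- The quotient of a family of entire functions by finitely many linear factors that depend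
continuously on the parameter is jointly continuous. -/
lemma continuous_quotient {Y κ : Type*} [TopologicalSpace Y] [CompactSpace Y] (F : Finset κ)
    {a : κ → Y → ℂ} (ha : ∀ i ∈ F, Continuous (a i)) {P G : Y → ℂ → ℂ}
    (hP : Continuous fun q : Y × ℂ => P q.1 q.2) (hG : ∀ y, Differentiable ℂ (G y))
    (hPG : ∀ y w, P y w = (∏ i ∈ F, (w - a i y)) * G y w) :
    Continuous fun q : Y × ℂ => G q.1 q.2 := by
  rw [continuous_iff_continuousAt]
  rintro ⟨y₀, w₀⟩
  obtain ⟨R, hR⟩ : ∃ R : ℝ, ∀ i ∈ F, ∀ y, ‖a i y‖ < R := by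
    have h1 : ∀ i ∈ F, ∃ C : ℝ, ∀ y, ‖a i y‖ ≤ C := fun i hi => by
      obtain ⟨C, hC⟩ := (isCompact_range (ha i hi)).isBounded.exists_norm_le
      exact ⟨C, fun y => hC _ (mem_range_self y)⟩
    choose! C hC using h1
    obtain ⟨M, hM⟩ := (F.image C).bddAbove
    refine ⟨M + 1, fun i hi y => ?_⟩
    have := hM (Finset.mem_coe.mpr (Finset.mem_image_of_mem C hi))
    linarith [hC i hi y]
  -- The circle of radius `r` encloses `w₀` and, uniformly in the parameter, all zeros `a i y`. On
  -- it the quotient can be formed explicitly; inside, the maximum principle applies.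
  set r := max (R + 1) (‖w₀‖ + 1) with hr
  have hrR : R < r := by linarith [le_max_left (R + 1) (‖w₀‖ + 1)]
  have hrw : ‖w₀‖ < r := by linarith [le_max_right (R + 1) (‖w₀‖ + 1)]
  have hr0 : r ≠ 0 := by linarith [norm_nonneg w₀]
  have hprod : ∀ y, ∀ s ∈ Metric.sphere (0 : ℂ) r, ∏ i ∈ F, (s - a i y) ≠ 0 := by
    intro y s hs
    refine Finset.prod_ne_zero_iff.mpr fun i hi h0 => ?_
    rw [sub_eq_zero.mp h0, mem_sphere_zero_iff_norm] at hs
    linarith [hR i hi y]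
  have hGQ : ∀ y, ∀ s ∈ Metric.sphere (0 : ℂ) r, G y s = P y s / ∏ i ∈ F, (s - a i y) := by
    intro y s hs
    rw [hPG, mul_div_cancel_left₀ _ (hprod y s hs)]
  rw [ContinuousAt, Metric.tendsto_nhds]
  intro ε hε
  have hunif : ∀ᶠ y in 𝓝 y₀, ∀ s ∈ Metric.sphere (0 : ℂ) r, ‖G y s - G y₀ s‖ < ε / 2 := by
    have hcpt := isCompact_sphere (0 : ℂ) r
    have h1 : ∀ᶠ y in 𝓝 y₀, ∀ s ∈ Metric.sphere (0 : ℂ) r,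
        ‖P y s / (∏ i ∈ F, (s - a i y)) - P y₀ s / (∏ i ∈ F, (s - a i y₀))‖ < ε / 2 := by
      refine hcpt.eventually_forall_of_forall_eventually fun s hs => ?_
      have hden : Continuous fun q : Y × ℂ => ∏ i ∈ F, (q.2 - a i q.1) :=
        continuous_finsetProd _ fun i hi => continuous_snd.sub ((ha i hi).comp continuous_fst)
      have hP₀ : Continuous fun q : Y × ℂ => P y₀ q.2 :=
        hP.comp (continuous_const.prodMk continuous_snd)
      have hden₀ : Continuous fun q : Y × ℂ => ∏ i ∈ F, (q.2 - a i y₀) := by fun_prop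
      have hc : ContinuousAt (fun q : Y × ℂ => ‖P q.1 q.2 / (∏ i ∈ F, (q.2 - a i q.1)) -
          P y₀ q.2 / (∏ i ∈ F, (q.2 - a i y₀))‖) (y₀, s) :=
        ((hP.continuousAt.div hden.continuousAt (hprod y₀ s hs)).sub
          (hP₀.continuousAt.div hden₀.continuousAt (hprod y₀ s hs))).norm
      exact hc.eventually_lt continuousAt_const (by simpa using hε)
    filter_upwards [h1] with y hy s hs
    rw [hGQ y s hs, hGQ y₀ s hs]
    exact hy s hs
  have hball : ∀ᶠ w in 𝓝 w₀, ‖w‖ < r ∧ ‖G y₀ w - G y₀ w₀‖ < ε / 2 := by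
    refine (continuous_norm.continuousAt.eventually_lt continuousAt_const hrw).and ?_
    have : ContinuousAt (fun w => ‖G y₀ w - G y₀ w₀‖) w₀ :=
      ((hG y₀).continuous.sub continuous_const).norm.continuousAt
    exact this.eventually_lt continuousAt_const (by simpa using hε)
  rw [nhds_prod_eq]
  filter_upwards [hunif.prod_mk hball] with ⟨y, w⟩ ⟨h1, h2, h3⟩
  have hmax : ‖G y w - G y₀ w‖ ≤ ε / 2 := by
    refine Complex.norm_le_of_forall_mem_frontier_norm_le (U := Metric.ball 0 r)
      (f := fun w => G y w - G y₀ w) Metric.isBounded_ball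
      ((hG y).sub (hG y₀)).diffContOnCl (fun s hs => ?_)
      (subset_closure (mem_ball_zero_iff.mpr h2))
    rw [frontier_ball _ hr0] at hs
    exact (h1 s hs).le
  rw [dist_eq_norm]
  calc ‖G y w - G y₀ w₀‖ = ‖(G y w - G y₀ w) + (G y₀ w - G y₀ w₀)‖ := by rw [sub_add_sub_cancel]
    _ ≤ ‖G y w - G y₀ w‖ + ‖G y₀ w - G y₀ w₀‖ := norm_add_le _ _
    _ < ε := by linarith

/-! ### The characteristic function -/

/-- The Peano-Baker series is a power series in ω dominated on each disk by an exponential series.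
-/
lemma Medium.monodromy_differentiable (X : Medium) (a b : Idx) :
    Differentiable ℂ fun w => X.monodromy w a b := by
  obtain ⟨C, hC, h⟩ := X.generator_bound
  intro w
  have hd : DifferentiableOn ℂ (fun w => ∑' j : ℕ, w ^ j * X.iter j 1 a b)
      (Metric.ball 0 (‖w‖ + 1)) := by
    refine Complex.differentiableOn_tsum_of_summable_norm
      (Real.summable_pow_div_factorial ((‖w‖ + 1) * (4 * C * 1))) (fun j => by fun_prop)
      Metric.isOpen_ball fun j z hz => ?_
    rw [norm_mul, norm_pow, mul_pow, mul_div_assoc]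
    have h1 := X.iter_bound hC h j 1 zero_le_one a b
    have h2 : ‖z‖ ≤ ‖w‖ + 1 := (mem_ball_zero_iff.mp hz).le
    gcongr
  exact hd.differentiableAt (Metric.isOpen_ball.mem_nhds (by simp))

lemma charFun_differentiable (X : Medium) (ξ : ℂ) : Differentiable ℂ (charFun X ξ) := by
  have : charFun X ξ = fun w => ∑ σ : Equiv.Perm Idx, (Equiv.Perm.sign σ : ℂ) *
      ∏ i, (X.monodromy w (σ i) i - ξ * (1 : Matrix Idx Idx ℂ) (σ i) i) := by
    funext w
    rw [charFun, Matrix.det_apply']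
    simp
  rw [this]
  refine Differentiable.fun_sum fun σ _ => ?_
  refine Differentiable.const_mul ?_ _
  refine Differentiable.fun_finsetProd fun i _ => ?_
  exact (X.monodromy_differentiable _ _).sub_const _

lemma charFun_continuous (X : Medium) :
    Continuous fun q : Circle × ℂ => charFun X q.1 q.2 := by
  refine Continuous.matrix_det ?_
  refine continuous_matrix fun i j => ?_
  have := (X.monodromy_differentiable i j).continuous
  simp only [Matrix.sub_apply, Matrix.smul_apply, smul_eq_mul]
  fun_prop

/-- The characteristic polynomial is det(ξ − M); the sign of det(M − ξ) agrees with it because the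
size 4 is even. -/
lemma charFun_eq_prod (X : Medium) (ξ w : ℂ) :
    charFun X ξ w = ((X.monodromy w).charpoly.roots.map fun l => ξ - l).prod := by
  rw [← (IsAlgClosed.splits _).eval_eq_prod_roots_of_monic (X.monodromy w).charpoly_monic,
    Matrix.eval_charpoly, charFun, ← neg_sub, Matrix.det_neg]
  simp [Matrix.smul_one_eq_diagonal, Matrix.scalar_apply, Even.neg_one_pow (show Even 4 by decide)]

/-! ### Bands, eigenvalue counts and the index. -/

section Bands

variable {X : Medium} {ι : Type*} {om : ι → Circle → ℂ}

lemma IsBandFamily.exists_iff_charFun_eq_zero (h : IsBandFamily X om) (ξ : Circle) (w : ℂ) :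
    (∃ n, om n ξ = w) ↔ charFun X ξ w = 0 := by
  have h1 := h.encard_eq ξ w
  have h2 := ((charFun_differentiable X ξ).analyticAt w).analyticOrderAt_ne_zero
  rw [← h2, ← h1, Set.encard_ne_zero]
  rfl

lemma IsBandFamily.norm_ne_one (h : IsBandFamily X om) {w : ℂ} (hw : w ∉ dispersionSet om) :
    ∀ l ∈ (X.monodromy w).charpoly.roots, ‖l‖ ≠ 1 := by
  intro l hl hl1
  have h0 : charFun X l w = 0 := by
    rw [charFun_eq_prod]
    exact Multiset.prod_eq_zero (Multiset.mem_map.mpr ⟨l, hl, sub_self l⟩)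
  obtain ⟨n, hn⟩ := (h.exists_iff_charFun_eq_zero ⟨l, mem_sphere_zero_iff_norm.mpr hl1⟩ w).mpr h0
  exact hw (mem_iUnion.mpr ⟨n, _, hn⟩)

/-- Off Γ no eigenvalue is unimodular, so the four eigenvalues split into those inside and those
outside the unit circle. -/
lemma IsBandFamily.ind_eq (h : IsBandFamily X om) {w : ℂ} (hw : w ∉ dispersionSet om) :
    ind X w = ((X.monodromy w).charpoly.roots.countP fun l => ‖l‖ < 1 : ℚ) - 2 := by
  set s := (X.monodromy w).charpoly.roots with hs
  have hcard : s.card = 4 := by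
    rw [hs, IsAlgClosed.card_roots_eq_natDegree, Matrix.charpoly_natDegree_eq_dim]
    rfl
  have h1 : s.countP (fun l => 1 < ‖l‖) = s.countP (fun l => ¬ ‖l‖ < 1) := by
    refine Multiset.countP_congr rfl fun l hl => ?_
    have := h.norm_ne_one hw l hl
    simp only [not_lt]
    exact propext ⟨le_of_lt, fun h2 => lt_of_le_of_ne h2 this.symm⟩
  have h2 := Multiset.card_eq_countP_add_countP (fun l : ℂ => ‖l‖ < 1) s
  rw [hcard, ← h1] at h2
  have h3 : (4 : ℚ) = (s.countP (fun l => ‖l‖ < 1) : ℚ) + (s.countP (fun l => 1 < ‖l‖) : ℚ) := by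
    exact_mod_cast h2
  rw [ind, ← hs]
  linarith

/-- Only finitely many bands meet a given disk at a given quasimomentum. -/
lemma IsBandFamily.finite_setOf_norm_le (h : IsBandFamily X om) {w₁ : ℂ}
    (hw₁ : w₁ ∉ dispersionSet om) (ξ : Circle) (R : ℝ) : {n | ‖om n ξ‖ ≤ R}.Finite := by
  have hd := charFun_differentiable X ξ
  have han : AnalyticOnNhd ℂ (charFun X ξ) univ := fun w _ => hd.analyticAt w
  have hne : charFun X ξ w₁ ≠ 0 := fun h0 => by
    obtain ⟨n, hn⟩ := (h.exists_iff_charFun_eq_zero ξ w₁).mpr h0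
    exact hw₁ (mem_iUnion.mpr ⟨n, _, hn⟩)
  have hzeros : {w | ‖w‖ ≤ R ∧ charFun X ξ w = 0}.Finite := by
    have h1 := han.preimage_zero_mem_codiscrete hne
    have h2 := (isCompact_closedBall (0 : ℂ) R).finite_sdiff_of_mem_codiscreteWithin
      (codiscreteWithin_mono (subset_univ _) h1)
    refine h2.subset fun w hw => ⟨mem_closedBall_zero_iff.mpr hw.1, fun h3 => h3 hw.2⟩
  -- Each of the finitely many zeros in the disk is taken by finitely many bands, because its order
  -- is finite: the function is nonzero at `w₁`.
  refine (hzeros.biUnion (t := fun w => {n | om n ξ = w}) fun w _ => ?_).subset fun n hn => ?_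
  · rw [← Set.encard_ne_top_iff, h.encard_eq]
    have h1 : analyticOrderAt (charFun X ξ) w₁ ≠ ⊤ := by
      rw [(hd.analyticAt w₁).analyticOrderAt_eq_zero.mpr hne]
      simp
    exact han.analyticOrderAt_ne_top_of_isPreconnected isPreconnected_univ (mem_univ w₁)
      (mem_univ w) h1
  · exact mem_biUnion (x := om n ξ)
      ⟨hn, (h.exists_iff_charFun_eq_zero ξ _).mp ⟨n, rfl⟩⟩ rfl

/-- Only finitely many bands meet a given disk. -/
lemma IsBandFamily.finite_setOf_exists_norm_le (h : IsBandFamily X om) {w₁ : ℂ}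
    (hw₁ : w₁ ∉ dispersionSet om) (R : ℝ) : {n | ∃ ξ, ‖om n ξ‖ ≤ R}.Finite := by
  have hlc : LocallyConnectedSpace Circle :=
    ChartedSpace.locallyConnectedSpace (EuclideanSpace ℝ (Fin 1)) Circle
  have key : {n | ∃ ξ ∈ (univ : Set Circle), ‖om n ξ‖ ≤ R}.Finite := by
    refine isCompact_univ.induction_on (p := fun U => {n | ∃ ξ ∈ U, ‖om n ξ‖ ≤ R}.Finite)
      (by simp) (fun U V hUV hV => hV.subset fun n ⟨ξ, hξ, hn⟩ => ⟨ξ, hUV hξ, hn⟩)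
      (fun U V hU hV => (hU.union hV).subset ?_) fun ξ₀ _ => ?_
    · rintro n ⟨ξ, hξ | hξ, hn⟩
      · exact Or.inl ⟨ξ, hξ, hn⟩
      · exact Or.inr ⟨ξ, hξ, hn⟩
    · have hfin := h.finite_setOf_norm_le hw₁ ξ₀ (R + 1)
      -- At `ξ₀` no band value has modulus `r`, and this persists for nearby ξ. On a connected
      -- neighbourhood a band therefore cannot pass from modulus at most `R` to modulus above `R +
      -- 1`.
      obtain ⟨r, hr, hr'⟩ : ∃ r ∈ Ioo R (R + 1),
          r ∉ (fun n => ‖om n ξ₀‖) '' {n | ‖om n ξ₀‖ ≤ R + 1} :=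
        ((Ioo_infinite (by linarith : R < R + 1)).sdiff (hfin.image _)).nonempty
      have hsph : ∀ᶠ ξ : Circle in 𝓝 ξ₀, ∀ w ∈ Metric.sphere (0 : ℂ) r, charFun X ξ w ≠ 0 := by
        refine (isCompact_sphere (0 : ℂ) r).eventually_forall_of_forall_eventually fun w hw => ?_
        refine (charFun_continuous X).continuousAt.eventually_ne (x := (ξ₀, w)) fun h0 => ?_
        obtain ⟨n, hn⟩ := (h.exists_iff_charFun_eq_zero ξ₀ w).mpr h0
        have hnr : ‖om n ξ₀‖ = r := by rw [hn]; exact mem_sphere_zero_iff_norm.mp hw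
        exact hr' ⟨n, by rw [mem_ofPred_eq, hnr]; exact hr.2.le, hnr⟩
      obtain ⟨U, ⟨hUo, hU₀, hUc⟩, hUsub⟩ :=
        (locallyConnectedSpace_iff_hasBasis_isOpen_isConnected.mp hlc ξ₀).mem_iff.mp hsph
      refine ⟨U, mem_nhdsWithin_of_mem_nhds (hUo.mem_nhds hU₀), hfin.subset ?_⟩
      rintro n ⟨ξ, hξ, hn⟩
      by_contra hcon
      have hcon' : R + 1 < ‖om n ξ₀‖ := not_le.mp hcon
      have hord := (hUc.isPreconnected.image (fun ξ => ‖om n ξ‖)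
        (h.continuous n).norm.continuousOn).ordConnected
      obtain ⟨ξ', hξ', hnr⟩ := hord.out (mem_image_of_mem _ hξ) (mem_image_of_mem _ hU₀)
        (show r ∈ Icc ‖om n ξ‖ ‖om n ξ₀‖ from ⟨by linarith [hr.1], by linarith [hr.2]⟩)
      exact hUsub hξ' (om n ξ') (mem_sphere_zero_iff_norm.mpr hnr)
        ((h.exists_iff_charFun_eq_zero ξ' _).mp ⟨n, rfl⟩)
  simpa using key

/-- The number of eigenvalues in the unit disk changes by the total change of the winding numbers
of the bands. -/
theorem IsBandFamily.countP_sub_eq (h : IsBandFamily X om) {w w' : ℂ}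
    (hw : w ∉ dispersionSet om) (hw' : w' ∉ dispersionSet om) {m m' : ι → ℤ}
    (hm : ∀ i, HasWindingNumber (om i) w (m i)) (hm' : ∀ i, HasWindingNumber (om i) w' (m' i))
    {n : ι} (hn : ∀ i, i ≠ n → m i = m' i) :
    ((X.monodromy w).charpoly.roots.countP fun l => ‖l‖ < 1 : ℤ) -
      ((X.monodromy w').charpoly.roots.countP fun l => ‖l‖ < 1 : ℤ) = m n - m' n := by
  classical
  set R := max ‖w‖ ‖w'‖ + 1 with hR
  -- `F` holds all bands that meet the disk containing `w` and `w'`; `n` is inserted by force so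
  -- that its term can be split off the sum at the end.
  have hfin := h.finite_setOf_exists_norm_le hw R
  set F := insert n hfin.toFinset with hF
  have hmem : ∀ i ξ, ‖om i ξ‖ ≤ R → i ∈ F := fun i ξ hi =>
    Finset.mem_insert_of_mem (hfin.mem_toFinset.mpr ⟨ξ, hi⟩)
  choose G hGd hPG hGo using fun ξ : Circle =>
    exists_eq_prod_mul F (fun i => om i ξ) (charFun_differentiable X ξ) fun w => by
      rw [← h.encard_eq]
      exact Set.encard_le_encard fun i hi => hi.2
  have hGc := continuous_quotient F (fun i _ => h.continuous i) (charFun_continuous X) hGd hPG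
  -- In the disk the bands of `F` account for the full order of every zero, so nothing is left for
  -- `G` to vanish on.
  have hG0 : ∀ ξ, ∀ z ∈ Metric.ball (0 : ℂ) R, G ξ z ≠ 0 := by
    intro ξ z hz
    have h1 := hGo ξ z
    have hset : {i | i ∈ F ∧ om i ξ = z} = {i | om i ξ = z} := by
      refine Set.ext fun i => ⟨fun hi => hi.2, fun hi => ⟨hmem i ξ ?_, hi⟩⟩
      rw [show om i ξ = z from hi]
      exact (mem_ball_zero_iff.mp hz).le
    have hne : Set.encard {i | i ∈ F ∧ om i ξ = z} ≠ ⊤ :=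
      Set.encard_ne_top_iff.mpr (F.finite_toSet.subset fun i hi => hi.1)
    rw [← h.encard_eq, ← hset] at h1
    have h2 : analyticOrderAt (G ξ) z = 0 := by
      have : Set.encard {i | i ∈ F ∧ om i ξ = z} + analyticOrderAt (G ξ) z =
        Set.encard {i | i ∈ F ∧ om i ξ = z} + 0 := by rw [← h1, add_zero]
      exact WithTop.add_left_cancel hne this
    exact ((hGd ξ).analyticAt z).analyticOrderAt_eq_zero.mp h2
  have hwR : w ∈ Metric.ball (0 : ℂ) R :=
    mem_ball_zero_iff.mpr (by linarith [le_max_left ‖w‖ ‖w'‖])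
  have hwR' : w' ∈ Metric.ball (0 : ℂ) R :=
    mem_ball_zero_iff.mpr (by linarith [le_max_right ‖w‖ ‖w'‖])
  have hGw : Continuous fun ξ => G ξ w := hGc.comp (continuous_id.prodMk continuous_const)
  obtain ⟨g, hg⟩ := exists_hasWindingNumber hGw fun ξ => hG0 ξ w hwR
  have hg' : HasWindingNumber (fun ξ => G ξ w') 0 g := by
    have : PreconnectedSpace (Metric.ball (0 : ℂ) R) :=
      isPreconnected_iff_preconnectedSpace.mp (convex_ball (0 : ℂ) R).isPreconnected
    exact hasWindingNumber_of_homotopy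
      (H := fun q : Metric.ball (0 : ℂ) R × Circle => G q.2 q.1)
      (hGc.comp (continuous_snd.prodMk (continuous_subtype_val.comp continuous_fst)))
      (fun q => hG0 _ _ q.1.2) (y := ⟨w, hwR⟩) (y' := ⟨w', hwR'⟩) hg
  have key : ∀ z ∉ dispersionSet om, ∀ d : ι → ℤ, (∀ i, HasWindingNumber (om i) z (d i)) →
      HasWindingNumber (fun ξ => G ξ z) 0 g →
      ((X.monodromy z).charpoly.roots.countP fun l => ‖l‖ < 1 : ℤ) = ∑ i ∈ F, d i + g := by
    intro z hz d hd hgz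
    have h1 := hasWindingNumber_multiset_prod _ (h.norm_ne_one hz)
    simp only [← charFun_eq_prod, hPG] at h1
    refine h1.unique (HasWindingNumber.mul (hasWindingNumber_prod F _ _ fun i _ => ?_) hgz)
    -- The linear factor is z − ω_i, the negative of ω_i − z; the constant −1 does not affect the
    -- winding number.
    have h2 := (hasWindingNumber_const (neg_ne_zero.mpr one_ne_zero)).mul
      (hasWindingNumber_sub.mpr (hd i))
    simpa using h2
  rw [key w hw m hm hg, key w' hw' m' hm' hg']
  have hnF : n ∈ F := Finset.mem_insert_self _ _
  rw [← Finset.add_sum_erase F m hnF, ← Finset.add_sum_erase F m' hnF,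
    Finset.sum_congr rfl fun i hi => hn i (Finset.ne_of_mem_erase hi)]
  ring

lemma IsPrincipalGapped.subset_compl_range {D : Set ℂ} (hD : IsPrincipalGapped X om D) (n : ι) :
    D ⊆ (range (om n))ᶜ := by
  obtain ⟨w, -, rfl, -⟩ := hD
  exact (connectedComponentIn_subset _ _).trans
    (compl_subset_compl.mpr (subset_iUnion (fun i => range (om i)) n))

/-- In the bounded component the index is the winding number of the band that is crossed. -/
theorem IsBandFamily.ind_eq_of_hasWindingNumber (h : IsBandFamily X om) {n : ι} {D : Set ℂ}
    (hD : IsPrincipalGapped X om D) (hDout : ∀ m, m ≠ n → Disjoint D (boundedRegion (om m)))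
    (hDn : (D ∩ exteriorRegion (om n)).Nonempty) {w : ℂ} (hw : w ∉ dispersionSet om)
    (hwm : ∀ m, m ≠ n → w ∉ boundedRegion (om m)) {σ : ℤ} (hσ : HasWindingNumber (om n) w σ) :
    ind X w = σ := by
  classical
  have hsub := hD.subset_compl_range
  obtain ⟨w₁, hw₁, rfl, hind⟩ := hD
  have hmem := mem_connectedComponentIn hw₁
  have h₁ : ∀ i, HasWindingNumber (om i) w₁ 0 := by
    intro i
    by_cases hi : i = n
    · subst hi
      obtain ⟨z, hz, hz'⟩ := hDn
      exact (hasWindingNumber_zero_of_mem_exteriorRegion (h.continuous i) hz').of_isPreconnected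
        (h.continuous i) isPreconnected_connectedComponentIn (hsub i) hz hmem
    · exact hasWindingNumber_zero_of_notMem_boundedRegion (h.continuous i) (hsub i hmem)
        (disjoint_left.mp (hDout i hi) hmem)
  have h₂ : ∀ i, HasWindingNumber (om i) w (if i = n then σ else 0) := by
    intro i
    split_ifs with hi
    · rwa [hi]
    · exact hasWindingNumber_zero_of_notMem_boundedRegion (h.continuous i)
        (fun hr => hw (mem_iUnion.mpr ⟨i, hr⟩)) (hwm i hi)
  have key := h.countP_sub_eq hw hw₁ h₂ h₁ (n := n) fun i hi => if_neg hi
  rw [if_pos rfl, sub_zero] at key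
  have key' : ((X.monodromy w).charpoly.roots.countP fun l => ‖l‖ < 1 : ℚ) -
      ((X.monodromy w₁).charpoly.roots.countP fun l => ‖l‖ < 1 : ℚ) = σ := by exact_mod_cast key
  rw [h.ind_eq hw₁] at hind
  rw [h.ind_eq hw]
  linarith

end Bands

end PhotonicCrystal

open PhotonicCrystal

/-! ### The index theorem for a bounded component. -/

theorem mainTheorem5
    -- a photonic crystal and its bands
    (X : Medium) {ι : Type*} (om : ι → Circle → ℂ) (hband : IsBandFamily X om)
    -- a principal gapped component `D` lying outside the regions enclosed by the curves `γ_m`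
    (n : ι) (D : Set ℂ) (hD : IsPrincipalGapped X om D)
    (hDout : ∀ m, m ≠ n → Disjoint D (boundedRegion (om m)))
    -- a bounded component `Dn` of the complement of `γ_n` with a simple closed curve as boundary
    (Dn : Set ℂ) (hDn : IsBoundedComponent (om n) Dn) (hJordan : IsSimpleClosedCurve (frontier Dn))
    -- assumption (i)
    (k₀ : ℝ) (ν : ℂ) (hk₀ : om n (Circle.exp k₀) ∈ frontier Dn)
    (hsmooth : IsSmoothPoint (om n) k₀) (hν : IsOutwardUnitNormal (om n) k₀ ν)
    (hside : ∀ᶠ t : ℝ in 𝓝[>] 0,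
      om n (Circle.exp k₀) + t * ν ∈ D ∧ om n (Circle.exp k₀) - t * ν ∈ Dn)
    -- assumption (ii)
    (hanalytic : IsAnalyticAtCircle (om n) (Circle.exp k₀)) :
    (IsPositivelyOriented (om n) (frontier Dn) →
      (∀ w ∈ (Dn \ ⋃ m ≠ n, boundedRegion (om m)) \ dispersionSet om, ind X w = 1) ∧
        ∀ wB ∈ Dn, HasWindingNumber (om n) wB 1) ∧
    (IsNegativelyOriented (om n) (frontier Dn) →
      (∀ w ∈ (Dn \ ⋃ m ≠ n, boundedRegion (om m)) \ dispersionSet om, ind X w = -1) ∧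
        ∀ wB ∈ Dn, HasWindingNumber (om n) wB (-1)) := by
  have hγ := hband.continuous n
  have hDext : (D ∩ exteriorRegion (om n)).Nonempty := by
    obtain ⟨t, ⟨h1, -⟩, h2⟩ := (hside.and hν.2.2).exists
    exact ⟨_, h1, h2⟩
  have hind : ∀ σ : ℤ, (∀ wB ∈ Dn, HasWindingNumber (om n) wB σ) →
      ∀ w ∈ (Dn \ ⋃ m ≠ n, boundedRegion (om m)) \ dispersionSet om, ind X w = σ := by
    intro σ hσ w hw
    refine hband.ind_eq_of_hasWindingNumber hD hDout hDext hw.2 (fun m hm hwm => ?_) (hσ w hw.1.1)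
    exact hw.1.2 (mem_iUnion₂.mpr ⟨m, hm, hwm⟩)
  constructor
  · intro hpos
    have hW : ∀ wB ∈ Dn, HasWindingNumber (om n) wB 1 := fun wB hwB =>
      hasWindingNumber_of_isBoundedComponent hγ hDn hk₀ hsmooth hν (Or.inl rfl)
        (by simpa using hpos k₀ ν hsmooth hk₀ hν) hwB
    exact ⟨fun w hw => by simpa using hind 1 hW w hw, hW⟩
  · intro hneg
    -- Negative orientation provides a smooth boundary point, possibly other than the one at `k₀`,
    -- with the opposite normal. The winding number in `Dn` may be computed there just as well.
    obtain ⟨k, ν', hs, hk, hν', hne⟩ : ∃ (k : ℝ) (ν' : ℂ), IsSmoothPoint (om n) k ∧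
        om n (Circle.exp k) ∈ frontier Dn ∧ IsOutwardUnitNormal (om n) k ν' ∧
        ν' ≠ -Complex.I * (tangent (om n) k / ‖tangent (om n) k‖) := by
      simpa [IsNegativelyOriented, IsPositivelyOriented] using hneg
    obtain ⟨σ, hσ, hσ'⟩ := eq_of_norm_eq_one_of_inner_eq_zero hs.2.1 hν'.1 hν'.2.1
    have hσ1 : σ = -1 := hσ.resolve_left fun h1 => hne (by rw [hσ', h1]; simp)
    have hW : ∀ wB ∈ Dn, HasWindingNumber (om n) wB (-1) := fun wB hwB =>
      hasWindingNumber_of_isBoundedComponent hγ hDn hk hs hν' (Or.inr rfl)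
        (by rw [hσ', hσ1]) hwB
    exact ⟨fun w hw => by simpa using hind (-1) hW w hw, hW⟩
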